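/- Let $\xi\in\mathbb{R}\setminus\{0\}$ and set $\xi_1=-\tfrac13\xi$, $\xi_2=\xi_3=\tfrac23\xi$. Let $a>0$, $b\in\mathbb{R}$ and pairwise distinct $a_1,a_2,a_3\in\mathbb{C}$ satisfy $$\sum_{k\neq j}\frac{\xi_k}{a_j-a_k}=2\pi i\,\overline{a_j}\,(a-ib),\qquad j=1,2,3,$$ so that $w_j(t)=a_jZ(t)$, $Z(t)=\sqrt{2at}\,e^{i\frac{b}{2a}\log t}$, $t>0$, is a self-similar burst out of the origin of three vortices with intensities $\xi_1,\xi_2,\xi_3$. For $T>0$ let $E_T=C([0,T),C^2(\mathbb{C},\mathbb{C}))\cap \mathrm{Lip}([0,T),C(\mathbb{C},\mathbb{C}))$, with norm $$\|f\|_{E_T}=\sup_{t\in[0,T)}\|f_t\|_{C^2}+\sup_{s\ne t\in[0,T)}\frac{\|f_t-f_s\|_\infty}{|t-s|},$$ where $\|g\|_{C^2}=\|g\|_\infty+\|Dg\|_\infty+\|D^2g\|_\infty$ (real derivatives; functions in $C^2(\mathbb{C},\mathbb{C})$ have finite norm). For an interval $I$ and $u:I\to\mathbb{C}$ let $[u]_{C^{1/2}(I)}=\sup_{s\neq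 t\in I}|u(t)-u(s)|/|t-s|^{1/2}$. Then for all $M,\rho>0$ there exists $T^*>0$ such that for every $0<T<T^*$ and every $f\in E_T$ with $\|f\|_{E_T}\le M$ there exists a $C^1$ curve $z=(z_1,z_2,z_3):(0,T)\to\mathbb{C}^3$ with $z_1(t),z_2(t),z_3(t)$ pairwise distinct for every $t$, such that $$\frac{d}{dt}\overline{z_j(t)}=\frac1{2\pi i}\sum_{k\ne j}\frac{\xi_k}{z_j(t)-z_k(t)}+f(t,z_j(t)),\qquad t\in(0,T),\ j=1,2,3,$$ and such that $\lim_{t\to0}z_j(t)=0$ and $[z_j]_{C^{1/2}((0,T))}\le 3\,[w_j]_{C^{1/2}((0,\infty))}$ for $j=1,2,3$, and $\sup_{0<t<T}|z(t)|\le\rho$. -/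

import Mathlib

open Set Filter Topology
open scoped ENNReal NNReal ComplexConjugate

namespace VortexBurst

/-- The `C^k` norm `‖g‖_∞ + ‖Dg‖_∞ + ⋯ + ‖D^k g‖_∞` of `g : ℂ → ℂ`, with real derivatives and with
values in `[0, ∞]`. -/
noncomputable def ckNorm (k : ℕ) (g : ℂ → ℂ) : ℝ≥0∞ :=
  ∑ i ∈ Finset.range (k + 1), ⨆ p : ℂ, ‖iteratedFDeriv ℝ i g p‖ₑ

/-- The supremum norm of `g : ℂ → ℂ`, with values in `[0, ∞]`. -/
noncomputable def supNorm (g : ℂ → ℂ) : ℝ≥0∞ := ⨆ p : ℂ, ‖g p‖ₑ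

/-- The Lipschitz seminorm on `[0, T)` of the field `f`, regarded as a function of time with values
in the space of bounded continuous functions of `p`. -/
noncomputable def lipSeminorm (T : ℝ) (f : ℝ → ℂ → ℂ) : ℝ≥0∞ :=
  ⨆ (s ∈ Ico 0 T) (t ∈ Ico 0 T) (_ : s ≠ t), supNorm (f t - f s) / ENNReal.ofReal |t - s|

/-- Membership in `E_T = C([0, T), C²(ℂ, ℂ)) ∩ Lip([0, T), C(ℂ, ℂ))`. Fields are represented by
functions on all of `ℝ × ℂ`, of which only the values at times in `[0, T)` matter. -/
structure MemE (T : ℝ) (f : ℝ → ℂ → ℂ) : Prop where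
  contDiff : ∀ t ∈ Ico 0 T, ContDiff ℝ 2 (f t)
  ckNorm_lt_top : ∀ t ∈ Ico 0 T, ckNorm 2 (f t) < ⊤
  continuous_time :
    ∀ t ∈ Ico 0 T, Tendsto (fun s => ckNorm 2 (f s - f t)) (𝓝[Ico 0 T] t) (𝓝 0)
  lip_lt_top : lipSeminorm T f < ⊤

/-- `‖f‖_{E_T} = sup_{t ∈ [0, T)} ‖f_t‖_{C²} + [f]_{Lip}`. -/
noncomputable def normE (T : ℝ) (f : ℝ → ℂ → ℂ) : ℝ≥0∞ :=
  (⨆ t ∈ Ico 0 T, ckNorm 2 (f t)) + lipSeminorm T f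

/-- The generalised diagonal of `ℂ³`. -/
def diagonal : Set (EuclideanSpace ℂ (Fin 3)) := {x | ∃ i j, i ≠ j ∧ x i = x j}

/-- The `C^{1/2}` seminorm on the time interval `I` of a curve in `ℂ`. -/
noncomputable def halfHolder (I : Set ℝ) (u : ℝ → ℂ) : ℝ≥0∞ :=
  eHolderNorm (1 / 2 : ℝ≥0) (I.domRestrict u)

/-- The intensities `ξ₁ = -ξ/3`, `ξ₂ = ξ₃ = 2ξ/3`. -/
noncomputable def intensity (ξ : ℝ) : Fin 3 → ℝ := ![-(1 / 3) * ξ, 2 / 3 * ξ, 2 / 3 * ξ]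

/-- The parameters `a > 0`, `b ∈ ℝ`, `α₁, α₂, α₃ ∈ ℂ` (distinct) define a self-similar burst of
three vortices with intensities `intensity ξ`. -/
structure IsBurstParam (ξ a b : ℝ) (α : Fin 3 → ℂ) : Prop where
  pos : 0 < a
  injective : Function.Injective α
  relation : ∀ j, ∑ k ∈ Finset.univ.erase j, (intensity ξ k : ℂ) / (α j - α k) =
    2 * Real.pi * Complex.I * conj (α j) * (a - Complex.I * b)

/-- `Z(t) = √(2at) exp(i (b / 2a) log t)`; the self-similar burst is `w_j(t) = α_j Z(t)`, `t > 0`. -/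
noncomputable def selfSimilar (a b : ℝ) (t : ℝ) : ℂ :=
  Real.sqrt (2 * a * t) * Complex.exp (Complex.I * (b / (2 * a) * Real.log t : ℝ))

/-- The curve `z : (0, T) → ℂ³ \ △³` solves the three-vortex system with external field `f`:
`d/dt conj z_j = (2πi)⁻¹ ∑_{k ≠ j} ξ_k / (z_j - z_k) + f(t, z_j)`. -/
def SolvesVortex (ξ T : ℝ) (f : ℝ → ℂ → ℂ) (z : ℝ → EuclideanSpace ℂ (Fin 3)) : Prop :=
  ∀ t ∈ Ioo 0 T, z t ∉ diagonal ∧ ∀ j,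
    HasDerivAt (fun s => conj (z s j))
      (1 / (2 * Real.pi * Complex.I) *
        ∑ k ∈ Finset.univ.erase j, (intensity ξ k : ℂ) / (z t j - z t k) + f t (z t j)) t

end VortexBurst

/-! In the variables `z_j = Z(t) (α_j + u_j)` the system becomes the singular equation `t u' = V(u)
+ g(t, u)`. Here `V` is `profileField`, which vanishes at `0`, and `g` is `profileForcing`, of size
`√t` because the external field is multiplied by `Z`. It suffices to find a small solution `u` near
time `0`.

In logarithmic time the linearisation of `V` at `0` has no eigenvalue of positive real part.
Translations are damped by `κ = burstRate a b`, with `Re κ = 1/2`. The two remaining complex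
directions, `α` and the `e` of `exists_direction`, form a triangular block whose diagonal parts are
both `w ↦ -2 κ Re w`, with eigenvalues `-1` and `0`. This structure comes from the conserved moments
(`moments`, `eq_mul_conj`), and the intensities enter through `∑_{j<k} ξ_j ξ_k = 0`.

Writing `u = t^(1/4) Ψ y(log t)` shifts the spectrum by `-1/4`, which damps the neutral directions
and absorbs their coupling (`exists_dissipative_coordinates`). The forcing divided by `t^(1/4)`
still vanishes as `t → 0`. A bounded `y` on a half-line of negative times is then the fixed point of
a contraction that averages the past (`exists_solution_of_contracting`, `exists_small_solution`).

For the Hölder bound, `z_j - w_j = Z u_j` has derivative at most `K / √t`, with `K` below the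
seminorm of every `w_j`. Integration gives `2K`, whence the factor `3 = 1 + 2`. -/

/-! ### Bounded solutions of contracting equations on a half-line of negative times. -/

section ExpAverage

open MeasureTheory

variable {E : Type*} [NormedAddCommGroup E] [NormedSpace ℝ E] {μ R : ℝ} {h k : ℝ → E}

/-- The average of the past of `h`, with exponential weight: the bounded solution of
`y' = μ (h - y)`. -/
noncomputable def expAverage (μ : ℝ) (h : ℝ → E) (s : ℝ) : E :=
  (μ * Real.exp (-(μ * s))) • ∫ r in Iic s, Real.exp (μ * r) • h r

theorem integrableOn_Iic_exp_smul (hμ : 0 < μ) (hm : AEStronglyMeasurable h)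
    (hR : ∀ s, ‖h s‖ ≤ R) (s : ℝ) :
    IntegrableOn (fun r => Real.exp (μ * r) • h r) (Iic s) :=
  Integrable.smul_bdd (integrableOn_exp_mul_Iic hμ s) R hm.restrict
    (Eventually.of_forall hR)

/-- The weight `μ exp (-μ (s - r))` on `r ≤ s` has total mass one. Averaging therefore preserves
both invariant balls and contraction constants. -/
theorem norm_expAverage_le (hμ : 0 < μ) (hR : ∀ s, ‖h s‖ ≤ R) (s : ℝ) :
    ‖expAverage μ h s‖ ≤ R := by
  have h1 : ‖∫ r in Iic s, Real.exp (μ * r) • h r‖ ≤ ∫ r in Iic s, Real.exp (μ * r) * R := by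
    apply norm_integral_le_of_norm_le ((integrableOn_exp_mul_Iic hμ s).mul_const R)
    refine Eventually.of_forall fun r => ?_
    rw [norm_smul, Real.norm_eq_abs, Real.abs_exp]
    exact mul_le_mul_of_nonneg_left (hR r) (Real.exp_pos _).le
  rw [integral_mul_const, integral_exp_mul_Iic hμ] at h1
  rw [expAverage, norm_smul, Real.norm_of_nonneg (by positivity)]
  calc μ * Real.exp (-(μ * s)) * ‖∫ r in Iic s, Real.exp (μ * r) • h r‖
      ≤ μ * Real.exp (-(μ * s)) * (Real.exp (μ * s) / μ * R) := by gcongr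
    _ = Real.exp (-(μ * s)) * Real.exp (μ * s) * R := by field_simp
    _ = R := by rw [← Real.exp_add]; simp

theorem expAverage_sub {R' : ℝ} (hμ : 0 < μ) (hm : AEStronglyMeasurable h)
    (hR : ∀ s, ‖h s‖ ≤ R) (hm' : AEStronglyMeasurable k) (hR' : ∀ s, ‖k s‖ ≤ R') (s : ℝ) :
    expAverage μ h s - expAverage μ k s = expAverage μ (fun r => h r - k r) s := by
  simp only [expAverage, smul_sub]
  rw [integral_sub (integrableOn_Iic_exp_smul hμ hm hR s)
    (integrableOn_Iic_exp_smul hμ hm' hR' s), smul_sub]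

/-- Splitting off a constant integral leaves an interval integral, to which the fundamental theorem
of calculus applies. -/
theorem expAverage_eq (hμ : 0 < μ) (hm : AEStronglyMeasurable h) (hR : ∀ s, ‖h s‖ ≤ R)
    (s : ℝ) : expAverage μ h s = (μ * Real.exp (-(μ * s))) •
      ((∫ r in Iic 0, Real.exp (μ * r) • h r) + ∫ r in (0 : ℝ)..s, Real.exp (μ * r) • h r) := by
  rw [expAverage, ← intervalIntegral.integral_Iic_sub_Iic
    (integrableOn_Iic_exp_smul hμ hm hR 0) (integrableOn_Iic_exp_smul hμ hm hR s)]
  simp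

theorem intervalIntegrable_exp_smul (hμ : 0 < μ) (hm : AEStronglyMeasurable h)
    (hR : ∀ s, ‖h s‖ ≤ R) (s t : ℝ) :
    IntervalIntegrable (fun r => Real.exp (μ * r) • h r) volume s t :=
  ⟨(integrableOn_Iic_exp_smul hμ hm hR t).mono_set fun _ hx => hx.2,
    (integrableOn_Iic_exp_smul hμ hm hR s).mono_set fun _ hx => hx.2⟩

theorem continuous_expAverage (hμ : 0 < μ) (hm : AEStronglyMeasurable h)
    (hR : ∀ s, ‖h s‖ ≤ R) : Continuous (expAverage μ h) := by
  rw [funext (expAverage_eq hμ hm hR)]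
  have := intervalIntegral.continuous_primitive (intervalIntegrable_exp_smul hμ hm hR) 0
  fun_prop

theorem hasDerivAt_expAverage [CompleteSpace E] (hμ : 0 < μ) (hm : AEStronglyMeasurable h)
    (hR : ∀ s, ‖h s‖ ≤ R) {s : ℝ} (hs : ContinuousAt h s)
    (hs' : StronglyMeasurableAtFilter h (𝓝 s) volume) :
    HasDerivAt (expAverage μ h) (μ • (h s - expAverage μ h s)) s := by
  have hexp : Continuous fun r : ℝ => Real.exp (μ * r) := by fun_prop
  have h1 := intervalIntegral.integral_hasDerivAt_right
    (intervalIntegrable_exp_smul hμ hm hR 0 s)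
    (by
      obtain ⟨t, ht, hmt⟩ := hs'
      exact ⟨t, ht, hexp.aestronglyMeasurable.smul hmt⟩)
    (hexp.continuousAt.smul hs)
  have h2 : HasDerivAt (fun s : ℝ => μ * Real.exp (-(μ * s)))
      (μ * (Real.exp (-(μ * s)) * -(μ * 1))) s :=
    (((hasDerivAt_id s).const_mul μ).neg.exp).const_mul μ
  have h3 := h2.smul (h1.const_add (∫ r in Iic 0, Real.exp (μ * r) • h r))
  refine (h3.congr_of_eventuallyEq
    (Eventually.of_forall (expAverage_eq hμ hm hR))).congr_deriv ?_
  rw [expAverage_eq hμ hm hR s, smul_sub, smul_smul, smul_smul, sub_eq_add_neg, ← neg_smul]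
  congr 2
  · rw [mul_assoc, ← Real.exp_add]; simp
  · ring

/-- An equation `y' = μ (H(s, y) - y)`, with `H` mapping a ball to itself and contracting in `y`,
has a solution which stays in that ball for all negative times. -/
theorem exists_solution_of_contracting [CompleteSpace E] {q s₀ : ℝ} (hμ : 0 < μ) (hR : 0 ≤ R)
    (hq : q < 1) {H : ℝ → E → E}
    (hcont : ContinuousOn (Function.uncurry H) (Iio s₀ ×ˢ Metric.closedBall 0 R))
    (hbound : ∀ s < s₀, ∀ x, ‖x‖ ≤ R → ‖H s x‖ ≤ R)
    (hlip : ∀ s < s₀, ∀ x y, ‖x‖ ≤ R → ‖y‖ ≤ R → ‖H s x - H s y‖ ≤ q * ‖x - y‖) :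
    ∃ y : ℝ → E, (∀ s, ‖y s‖ ≤ R) ∧ ∀ s < s₀, HasDerivAt y (μ • (H s (y s) - y s)) s := by
  classical
  -- Extension by `0` beyond `s₀` makes the average defined at all times. It does not affect times
  -- before `s₀`, since only the past is averaged.
  let Q : (BoundedContinuousFunction ℝ E) → ℝ → E := fun y =>
    (Iio s₀).indicator fun s => H s (y s)
  let B : Set (BoundedContinuousFunction ℝ E) := Metric.closedBall 0 R
  have hB : ∀ y ∈ B, ∀ s, ‖y s‖ ≤ R := fun y hy s =>
    (y.norm_coe_le_norm s).trans (by simpa [B] using hy)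
  have hQc : ∀ y ∈ B, ContinuousOn (fun s => H s (y s)) (Iio s₀) := fun y hy =>
    hcont.comp (f := fun s => (s, y s)) (by fun_prop)
      fun s hs => ⟨hs, by simpa using hB y hy s⟩
  have hQm : ∀ y ∈ B, AEStronglyMeasurable (Q y) := fun y hy =>
    (aestronglyMeasurable_indicator_iff measurableSet_Iio).2
      ((hQc y hy).aestronglyMeasurable measurableSet_Iio)
  have hQb : ∀ y ∈ B, ∀ s, ‖Q y s‖ ≤ R := by
    intro y hy s
    by_cases hs : s ∈ Iio s₀
    · simpa only [Q, indicator_of_mem hs] using hbound s hs _ (hB y hy s)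
    · simpa only [Q, indicator_of_notMem hs, norm_zero] using hR
  let Φ : (BoundedContinuousFunction ℝ E) → (BoundedContinuousFunction ℝ E) := fun y =>
    if hy : y ∈ B then BoundedContinuousFunction.ofNormedAddCommGroup (expAverage μ (Q y))
      (continuous_expAverage hμ (hQm y hy) (hQb y hy)) R (norm_expAverage_le hμ (hQb y hy))
    else 0
  have hΦ : ∀ y ∈ B, ∀ s, Φ y s = expAverage μ (Q y) s := by
    intro y hy s
    simp [Φ, hy]
  have hmaps : MapsTo Φ B B := by
    intro y hy
    rw [mem_closedBall_zero_iff, BoundedContinuousFunction.norm_le hR]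
    intro s
    rw [hΦ y hy]
    exact norm_expAverage_le hμ (hQb y hy) s
  have hcontr : ContractingWith q.toNNReal (hmaps.restrict Φ B B) := by
    refine ⟨by simpa using hq, LipschitzWith.of_dist_le_mul fun x y => ?_⟩
    change dist (Φ x) (Φ y) ≤ _ * dist (x : BoundedContinuousFunction ℝ E) y
    rw [BoundedContinuousFunction.dist_le (by positivity)]
    intro s
    rw [hΦ _ x.2, hΦ _ y.2, dist_eq_norm, expAverage_sub hμ (hQm x x.2) (hQb x x.2)
      (hQm y y.2) (hQb y y.2)]
    refine norm_expAverage_le hμ (fun r => ?_) s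
    by_cases hr : r ∈ Iio s₀
    · simp only [Q, indicator_of_mem hr]
      refine (hlip r hr _ _ (hB x x.2 r) (hB y y.2 r)).trans ?_
      rw [← dist_eq_norm]
      gcongr
      · exact Real.le_coe_toNNReal q
      · exact BoundedContinuousFunction.dist_coe_le_dist r
    · simp only [Q, indicator_of_notMem hr, sub_zero, norm_zero]
      positivity
  obtain ⟨y, hy, hfix, -⟩ := hcontr.exists_fixedPoint' (x := 0)
    Metric.isClosed_closedBall.isComplete hmaps (by simpa [B] using hR) (edist_ne_top _ _)
  refine ⟨y, hB y hy, fun s hs => ?_⟩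
  have hfix' : (y : ℝ → E) = expAverage μ (Q y) := by
    funext s
    rw [← hΦ y hy, hfix]
  have hnhds : Iio s₀ ∈ 𝓝 s := Iio_mem_nhds hs
  have hev : Q y =ᶠ[𝓝 s] fun s => H s (y s) :=
    Filter.eventually_of_mem hnhds fun r hr => indicator_of_mem hr _
  have h := hasDerivAt_expAverage hμ (hQm y hy) (hQb y hy) (s := s)
    (((hQc y hy).continuousAt hnhds).congr hev.symm)
    ⟨univ, univ_mem, (hQm y hy).restrict⟩
  rw [← hfix'] at h
  simpa only [Q, indicator_of_mem (show s ∈ Iio s₀ from hs)] using h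

end ExpAverage

/-! ### Small solutions of a singular equation at time zero. -/

/-- A singular equation `t u' = V(u) + g(t, u)`, where `V(0) = 0`, where the derivative of `V` at
`0`, shifted by `-1/4`, is dissipative in suitable coordinates, and where `g` is a perturbation of
size `√t`, has a small solution near time `0`. -/
theorem exists_small_solution {E : Type*} [NormedAddCommGroup E] [NormedSpace ℝ E]
    [CompleteSpace E] {V : E → E} {L : E →L[ℝ] E} (hV : HasStrictFDerivAt V L 0) (hV0 : V 0 = 0)
    (Ψ : E ≃L[ℝ] E) {η q : ℝ} (hη : 0 < η) (hq0 : 0 ≤ q) (hq : q < 1)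
    (hdiss : ∀ y, ‖y + η • (Ψ.symm (L (Ψ y)) - (1 / 4 : ℝ) • y)‖ ≤ q * ‖y‖)
    {C δ : ℝ} (hC : 0 < C) (hδ : 0 < δ) :
    ∃ Tstar > 0, ∀ T, 0 < T → T < Tstar → ∀ g : ℝ → E → E,
      ContinuousOn (Function.uncurry g) (Ioo 0 T ×ˢ univ) →
      (∀ t ∈ Ioo 0 T, ∀ x y, ‖g t x - g t y‖ ≤ C * t * ‖x - y‖) →
      (∀ t ∈ Ioo 0 T, ∀ x, ‖g t x‖ ≤ C * √t) →
      ∃ u : ℝ → E, (∀ t ∈ Ioo 0 T, ‖u t‖ ≤ δ ∧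
        HasDerivAt u (t⁻¹ • (V (u t) + g t (u t))) t) ∧ ContDiffOn ℝ 1 u (Ioo 0 T) := by
  obtain ⟨P, hP0, hP⟩ : ∃ P > 0, ∀ y, ‖Ψ y‖ ≤ P * ‖y‖ :=
    (Ψ : E →L[ℝ] E).bound
  obtain ⟨S, hS0, hS⟩ : ∃ S > 0, ∀ y, ‖Ψ.symm y‖ ≤ S * ‖y‖ :=
    (Ψ.symm : E →L[ℝ] E).bound
  -- the nonlinear part of `V` and the perturbation cost at most `(1 - q) / 2`
  obtain ⟨ε, hε0, hε⟩ : ∃ ε > 0, η * S * P * ε ≤ (1 - q) / 4 :=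
    ⟨(1 - q) / 4 / (η * S * P), div_pos (by linarith) (by positivity), by
      rw [mul_div_cancel₀]; positivity⟩
  obtain ⟨N, hN, happ⟩ := hV.approximates_deriv_on_nhds (c := ⟨ε, hε0.le⟩) (Or.inr hε0)
  obtain ⟨r, hr0, hr⟩ := Metric.nhds_basis_closedBall.mem_iff.1 hN
  have hVc : ContinuousOn V (Metric.closedBall 0 r) := happ.continuousOn.mono hr
  obtain ⟨D, hD0, hD, hDr⟩ : ∃ D > 0, P * D ≤ δ ∧ P * D ≤ r :=
    ⟨min δ r / P, by positivity, by
      rw [mul_div_cancel₀ _ hP0.ne']; exact min_le_left _ _, by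
      rw [mul_div_cancel₀ _ hP0.ne']; exact min_le_right _ _⟩
  obtain ⟨T₁, hT₁0, hT₁⟩ : ∃ T₁ > 0, η * S * P * (C * T₁) ≤ (1 - q) / 4 :=
    ⟨(1 - q) / 4 / (η * S * P * C), div_pos (by linarith) (by positivity), by
      field_simp; rfl⟩
  obtain ⟨T₂, hT₂0, hT₂⟩ : ∃ T₂ > 0, η * S * C * T₂ ≤ (1 - q) / 2 * D :=
    ⟨(1 - q) / 2 * D / (η * S * C),
      div_pos (mul_pos (by linarith) hD0) (by positivity), by field_simp; rfl⟩
  -- The bound `1` keeps the weight `t^(1/4)` at most one, `T₁` controls the Lipschitz constant of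
  -- `g`, and the fourth power turns the condition on `T₂` into one on the weight.
  refine ⟨min 1 (min T₁ (T₂ ^ 4)), by positivity, fun T hT0 hT g hgc hgl hgb => ?_⟩
  have hTone : T < 1 := hT.trans_le (min_le_left _ _)
  have hTT₁ : T < T₁ := hT.trans_le ((min_le_right _ _).trans (min_le_left _ _))
  have hTT₂ : T < T₂ ^ 4 := hT.trans_le ((min_le_right _ _).trans (min_le_right _ _))
  -- The exponent lies strictly between `0`, so that neutral directions become damped, and the
  -- exponent `1/2` of the forcing.
  let w : ℝ → ℝ := fun s => Real.exp (s / 4)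
  let W : ℝ → E → E := fun t x => V x + g t x
  -- An Euler step of length `η` for the equation of `y`: the required equation reads `y' = η⁻¹
  -- (H(s, y) - y)`.
  let H : ℝ → E → E := fun s y =>
    (1 - η / 4) • y + η • Ψ.symm ((w s)⁻¹ • W (Real.exp s) (w s • Ψ y))
  have hw0 : ∀ s, 0 < w s := fun s => Real.exp_pos _
  have hw4 : ∀ s, w s ^ 4 = Real.exp s := fun s => by
    rw [← Real.exp_nat_mul]; congr 1; push_cast; ring
  have hexp : ∀ s < Real.log T, Real.exp s ∈ Ioo 0 T := fun s hs =>
    ⟨Real.exp_pos s, by rwa [← Real.lt_log_iff_exp_lt hT0]⟩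
  have hw1 : ∀ s < Real.log T, w s ≤ 1 := fun s hs => by
    by_contra hcon
    have := one_lt_pow₀ (not_le.1 hcon) (n := 4) (by norm_num)
    rw [hw4] at this
    linarith [(hexp s hs).2]
  have hwT₂ : ∀ s < Real.log T, w s ≤ T₂ := fun s hs => by
    by_contra hcon
    have := pow_lt_pow_left₀ (not_le.1 hcon) hT₂0.le (n := 4) (by norm_num)
    rw [hw4] at this
    linarith [(hexp s hs).2]
  have hwsq : ∀ s, √(Real.exp s) = w s ^ 2 := fun s => by
    rw [← hw4, show w s ^ 4 = (w s ^ 2) ^ 2 by ring, Real.sqrt_sq (by positivity)]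
  have hnorm : ∀ s < Real.log T, ∀ y, ‖y‖ ≤ D → ‖w s • Ψ y‖ ≤ P * D := fun s hs y hy => by
    rw [norm_smul, Real.norm_of_nonneg (hw0 s).le]
    calc w s * ‖Ψ y‖ ≤ 1 * (P * D) := by
          refine mul_le_mul (hw1 s hs) ((hP y).trans ?_) (norm_nonneg _) zero_le_one
          gcongr
      _ = P * D := one_mul _
  have hmem : ∀ s < Real.log T, ∀ y, ‖y‖ ≤ D → w s • Ψ y ∈ Metric.closedBall (0 : E) r :=
    fun s hs y hy => by simpa using (hnorm s hs y hy).trans hDr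
  have hWc : ContinuousOn (Function.uncurry W) (Ioo 0 T ×ˢ Metric.closedBall 0 r) :=
    (hVc.comp continuousOn_snd fun x hx => hx.2).add
      (hgc.mono (prod_mono_right (subset_univ _)))
  have hHc : ContinuousOn (Function.uncurry H) (Iio (Real.log T) ×ˢ Metric.closedBall 0 D) := by
    have h1 : ContinuousOn (fun x : ℝ × E => W (Real.exp x.1) (w x.1 • Ψ x.2))
        (Iio (Real.log T) ×ˢ Metric.closedBall 0 D) :=
      hWc.comp (f := fun x : ℝ × E => (Real.exp x.1, w x.1 • Ψ x.2))
        (Continuous.continuousOn (by fun_prop)) fun x hx =>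
        ⟨hexp _ hx.1, hmem _ hx.1 _ (by simpa using hx.2)⟩
    have h2 : Continuous fun x : ℝ × E => (w x.1)⁻¹ :=
      Continuous.inv₀ (by fun_prop) fun x => (hw0 _).ne'
    have h3 : ContinuousOn (fun x : ℝ × E => (1 - η / 4) • x.2 +
        η • Ψ.symm ((w x.1)⁻¹ • W (Real.exp x.1) (w x.1 • Ψ x.2)))
        (Iio (Real.log T) ×ˢ Metric.closedBall 0 D) :=
      (Continuous.continuousOn (by fun_prop)).add
        ((Ψ.symm.continuous.comp_continuousOn (h2.continuousOn.smul h1)).const_smul η)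
    exact h3
  have hHl : ∀ s < Real.log T, ∀ x y, ‖x‖ ≤ D → ‖y‖ ≤ D →
      ‖H s x - H s y‖ ≤ (q + (1 - q) / 2) * ‖x - y‖ := by
    intro s hs x y hx hy
    have hw := hw0 s
    -- The weight cancels from the linear part, which is left to `hdiss`. The rest is the nonlinear
    -- remainder of `V` and the variation of `g`.
    have e1 : H s x - H s y =
        ((x - y) + η • (Ψ.symm (L (Ψ (x - y))) - (1 / 4 : ℝ) • (x - y))) +
        η • Ψ.symm ((w s)⁻¹ • ((V (w s • Ψ x) - V (w s • Ψ y) - L (w s • Ψ x - w s • Ψ y)) +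
          (g (Real.exp s) (w s • Ψ x) - g (Real.exp s) (w s • Ψ y)))) := by
      simp only [H, W, map_sub, map_smul, map_add, smul_sub, smul_add, smul_smul, sub_smul,
        one_smul, inv_mul_cancel₀ hw.ne']
      module
    have hd : ‖w s • Ψ x - w s • Ψ y‖ ≤ w s * (P * ‖x - y‖) := by
      rw [← smul_sub, ← map_sub, norm_smul, Real.norm_of_nonneg hw.le]
      gcongr
      exact hP _
    have e2 : ‖V (w s • Ψ x) - V (w s • Ψ y) - L (w s • Ψ x - w s • Ψ y)‖ ≤
        ε * (w s * (P * ‖x - y‖)) :=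
      (happ _ (hr (hmem s hs x hx)) _ (hr (hmem s hs y hy))).trans
        (mul_le_mul_of_nonneg_left hd hε0.le)
    have e3 : ‖g (Real.exp s) (w s • Ψ x) - g (Real.exp s) (w s • Ψ y)‖ ≤
        C * T₁ * (w s * (P * ‖x - y‖)) := by
      refine (hgl _ (hexp s hs) _ _).trans ?_
      have := (hexp s hs).2.le.trans hTT₁.le
      gcongr
    have e4 : ‖η • Ψ.symm ((w s)⁻¹ • ((V (w s • Ψ x) - V (w s • Ψ y) -
        L (w s • Ψ x - w s • Ψ y)) +
          (g (Real.exp s) (w s • Ψ x) - g (Real.exp s) (w s • Ψ y))))‖ ≤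
        η * (S * ((w s)⁻¹ * (ε * (w s * (P * ‖x - y‖)) + C * T₁ * (w s * (P * ‖x - y‖))))) := by
      rw [norm_smul, Real.norm_of_nonneg hη.le]
      gcongr
      refine (hS _).trans ?_
      rw [norm_smul, Real.norm_of_nonneg (inv_pos.2 hw).le]
      gcongr
      exact (norm_add_le _ _).trans (add_le_add e2 e3)
    have e5 : η * (S * ((w s)⁻¹ * (ε * (w s * (P * ‖x - y‖)) +
        C * T₁ * (w s * (P * ‖x - y‖))))) =
        (η * S * P * ε + η * S * P * (C * T₁)) * ‖x - y‖ := by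
      field_simp
    rw [e1]
    refine (norm_add_le _ _).trans ((add_le_add (hdiss _) (e4.trans_eq e5)).trans ?_)
    rw [← add_mul]
    gcongr
    linarith
  have hH0 : ∀ s < Real.log T, ‖H s 0‖ ≤ (1 - q) / 2 * D := by
    intro s hs
    have hw := hw0 s
    have : H s 0 = η • Ψ.symm ((w s)⁻¹ • g (Real.exp s) 0) := by simp [H, W, hV0]
    rw [this, norm_smul, Real.norm_of_nonneg hη.le]
    calc η * ‖Ψ.symm ((w s)⁻¹ • g (Real.exp s) 0)‖
        ≤ η * (S * ((w s)⁻¹ * (C * w s ^ 2))) := by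
          gcongr
          refine (hS _).trans ?_
          rw [norm_smul, Real.norm_of_nonneg (inv_pos.2 hw).le, ← hwsq]
          gcongr
          exact hgb _ (hexp s hs) _
      _ = η * S * C * w s := by field_simp
      _ ≤ η * S * C * T₂ := by gcongr; exact hwT₂ s hs
      _ ≤ _ := hT₂
  -- The budget closes exactly: contraction takes `q + (1 - q) / 2` of the radius and the value at
  -- `0` takes the other `(1 - q) / 2`.
  have hHb : ∀ s < Real.log T, ∀ x, ‖x‖ ≤ D → ‖H s x‖ ≤ D := by
    intro s hs x hx
    have h1 := hHl s hs x 0 hx (by simpa using hD0.le)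
    rw [sub_zero] at h1
    have h2 : (q + (1 - q) / 2) * ‖x‖ ≤ (q + (1 - q) / 2) * D := by
      gcongr
    have h3 : ‖H s x‖ ≤ ‖H s x - H s 0‖ + ‖H s 0‖ := by
      simpa using norm_add_le (H s x - H s 0) (H s 0)
    linarith [hH0 s hs]
  obtain ⟨y, hyD, hy⟩ := exists_solution_of_contracting (μ := η⁻¹) (inv_pos.2 hη) hD0.le
    (q := q + (1 - q) / 2) (by linarith) hHc hHb hHl
  have hlog : ∀ t ∈ Ioo 0 T, Real.log t < Real.log T := fun t ht => Real.log_lt_log ht.1 ht.2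
  have hu : ∀ t ∈ Ioo 0 T, ‖w (Real.log t) • Ψ (y (Real.log t))‖ ≤ P * D := fun t ht =>
    hnorm _ (hlog t ht) _ (hyD _)
  have hder : ∀ t ∈ Ioo 0 T, HasDerivAt (fun t => w (Real.log t) • Ψ (y (Real.log t)))
      (t⁻¹ • W t (w (Real.log t) • Ψ (y (Real.log t)))) t := by
    intro t ht
    have h1 := Real.hasDerivAt_log ht.1.ne'
    have h2 : HasDerivAt w (w (Real.log t) * (1 / 4)) (Real.log t) :=
      ((hasDerivAt_id (Real.log t)).div_const 4).exp
    have h3 := (Ψ : E →L[ℝ] E).hasFDerivAt.comp_hasDerivAt _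
      ((hy _ (hlog t ht)).scomp t h1)
    have h4 := (h2.comp t h1).smul h3
    refine h4.congr_deriv ?_
    have hw := (hw0 (Real.log t)).ne'
    simp only [H, Function.comp, ContinuousLinearEquiv.coe_coe, map_smul, map_add, map_sub,
      ContinuousLinearEquiv.apply_symm_apply, Real.exp_log ht.1]
    simp only [smul_sub, smul_add, smul_smul]
    rw [show w (Real.log t) * (t⁻¹ * (η⁻¹ * (η * (w (Real.log t))⁻¹))) = t⁻¹ by
      field_simp]
    match_scalars <;> field_simp
    ring
  refine ⟨fun t => w (Real.log t) • Ψ (y (Real.log t)), fun t ht =>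
    ⟨(hu t ht).trans hD, hder t ht⟩, ?_⟩
  have hdiff : DifferentiableOn ℝ (fun t => w (Real.log t) • Ψ (y (Real.log t))) (Ioo 0 T) :=
    fun t ht => (hder t ht).differentiableAt.differentiableWithinAt
  have h0 := contDiffOn_succ_iff_deriv_of_isOpen (𝕜 := ℝ) (n := 0)
    (f := fun t => w (Real.log t) • Ψ (y (Real.log t))) (isOpen_Ioo (a := 0) (b := T))
  rw [zero_add] at h0
  refine h0.2 ⟨hdiff, by simp, contDiffOn_zero.2 ?_⟩
  refine ContinuousOn.congr ?_ fun t ht => (hder t ht).deriv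
  refine (continuousOn_inv₀.mono fun t ht => ht.1.ne').smul ?_
  exact hWc.comp (f := fun t => (t, w (Real.log t) • Ψ (y (Real.log t))))
    (continuousOn_id.prodMk hdiff.continuousOn) fun t ht =>
    ⟨ht, by simpa using (hu t ht).trans hDr⟩

/-! ### Algebra of the linearised three-vortex field. -/

namespace VortexBurst

open Complex

variable {ξ a b : ℝ} {α : Fin 3 → ℂ}

theorem sum_erase_zero (g : Fin 3 → ℂ) : ∑ k ∈ Finset.univ.erase 0, g k = g 1 + g 2 := by
  rw [show Finset.univ.erase (0 : Fin 3) = {1, 2} by decide, Finset.sum_pair (by decide)]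

theorem sum_erase_one (g : Fin 3 → ℂ) : ∑ k ∈ Finset.univ.erase 1, g k = g 0 + g 2 := by
  rw [show Finset.univ.erase (1 : Fin 3) = {0, 2} by decide, Finset.sum_pair (by decide)]

theorem sum_erase_two (g : Fin 3 → ℂ) : ∑ k ∈ Finset.univ.erase 2, g k = g 0 + g 1 := by
  rw [show Finset.univ.erase (2 : Fin 3) = {0, 1} by decide, Finset.sum_pair (by decide)]

/-- The velocity field generated by three vortices, up to conjugation. -/
noncomputable def vortexField (ξ : ℝ) (z : Fin 3 → ℂ) (j : Fin 3) : ℂ :=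
  1 / (2 * Real.pi * I) * ∑ k ∈ Finset.univ.erase j, (intensity ξ k : ℂ) / (z j - z k)

/-- The derivative of `vortexField` at `α` in the direction `v`. -/
noncomputable def vortexFieldDeriv (ξ : ℝ) (α v : Fin 3 → ℂ) (j : Fin 3) : ℂ :=
  1 / (2 * Real.pi * I) *
    ∑ k ∈ Finset.univ.erase j, -(intensity ξ k : ℂ) / (α j - α k) ^ 2 * (v j - v k)

/-- Half of the complex rate at which a self-similar burst expands, in logarithmic time. -/
noncomputable def burstRate (a b : ℝ) : ℂ := (a + I * b) / (2 * a)

theorem two_pi_mul_I_ne_zero : (2 * Real.pi * I : ℂ) ≠ 0 := by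
  simp [Real.pi_ne_zero, I_ne_zero]

namespace IsBurstParam

theorem sub_ne_zero (h : IsBurstParam ξ a b α) {j k : Fin 3} (hjk : j ≠ k) : α j - α k ≠ 0 :=
  _root_.sub_ne_zero.2 fun e => hjk (h.injective e)

theorem vortexField_eq (h : IsBurstParam ξ a b α) (j : Fin 3) :
    vortexField ξ α j = conj (α j) * (a - I * b) := by
  rw [vortexField, h.relation j]
  have := two_pi_mul_I_ne_zero
  field_simp

/-- Euler's identity for a field homogeneous of degree `-1`. -/
theorem vortexFieldDeriv_self (h : IsBurstParam ξ a b α) (j : Fin 3) :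
    vortexFieldDeriv ξ α α j = -(conj (α j) * (a - I * b)) := by
  rw [← h.vortexField_eq, vortexFieldDeriv, vortexField, ← mul_neg, ← Finset.sum_neg_distrib]
  congr 1
  refine Finset.sum_congr rfl fun k hk => ?_
  have := h.sub_ne_zero (Finset.ne_of_mem_erase hk).symm
  field_simp

theorem rate_ne_zero (h : IsBurstParam ξ a b α) : (a - I * b : ℂ) ≠ 0 := fun e =>
  h.pos.ne' (by simpa using congrArg re e)

/-- Naming the inverse differences makes the later identities polynomial, within reach of
`linear_combination`. -/
theorem exists_inverses (h : IsBurstParam ξ a b α) : ∃ p q r : ℂ,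
    (p * (α 0 - α 1) = 1 ∧ q * (α 0 - α 2) = 1 ∧ r * (α 1 - α 2) = 1) ∧
    (2 / 3 * ξ * (p + q) = 2 * Real.pi * I * conj (α 0) * (a - I * b) ∧
      1 / 3 * ξ * p + 2 / 3 * ξ * r = 2 * Real.pi * I * conj (α 1) * (a - I * b) ∧
      1 / 3 * ξ * q - 2 / 3 * ξ * r = 2 * Real.pi * I * conj (α 2) * (a - I * b)) ∧
    ∀ v, vortexFieldDeriv ξ α v 0 = 1 / (2 * Real.pi * I) *
        (-(2 / 3 * ξ) * (p ^ 2 * (v 0 - v 1) + q ^ 2 * (v 0 - v 2))) ∧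
      vortexFieldDeriv ξ α v 1 = 1 / (2 * Real.pi * I) *
        (1 / 3 * ξ * p ^ 2 * (v 1 - v 0) - 2 / 3 * ξ * r ^ 2 * (v 1 - v 2)) ∧
      vortexFieldDeriv ξ α v 2 = 1 / (2 * Real.pi * I) *
        (1 / 3 * ξ * q ^ 2 * (v 2 - v 0) - 2 / 3 * ξ * r ^ 2 * (v 2 - v 1)) := by
  have d01 := h.sub_ne_zero (show (0 : Fin 3) ≠ 1 by decide)
  have d02 := h.sub_ne_zero (show (0 : Fin 3) ≠ 2 by decide)
  have d12 := h.sub_ne_zero (show (1 : Fin 3) ≠ 2 by decide)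
  have e10 : α 1 - α 0 = -(α 0 - α 1) := by ring
  have e20 : α 2 - α 0 = -(α 0 - α 2) := by ring
  have e21 : α 2 - α 1 = -(α 1 - α 2) := by ring
  refine ⟨(α 0 - α 1)⁻¹, (α 0 - α 2)⁻¹, (α 1 - α 2)⁻¹, ⟨inv_mul_cancel₀ d01,
    inv_mul_cancel₀ d02, inv_mul_cancel₀ d12⟩, ⟨?_, ?_, ?_⟩, fun v => ⟨?_, ?_, ?_⟩⟩
  · rw [← h.relation 0, sum_erase_zero]
    simp only [intensity, Matrix.cons_val_zero, Matrix.cons_val_one, Matrix.cons_val]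
    push_cast; ring
  · rw [← h.relation 1, sum_erase_one, e10]
    simp only [intensity, Matrix.cons_val_zero, Matrix.cons_val, div_neg]
    push_cast; ring
  · rw [← h.relation 2, sum_erase_two, e20, e21]
    simp only [intensity, Matrix.cons_val_zero, Matrix.cons_val_one, div_neg]
    push_cast; ring
  · rw [vortexFieldDeriv, sum_erase_zero]
    simp only [intensity, Matrix.cons_val_zero, Matrix.cons_val_one, Matrix.cons_val, inv_pow]
    push_cast; ring
  · rw [vortexFieldDeriv, sum_erase_one, e10, neg_sq]
    simp only [intensity, Matrix.cons_val_zero, Matrix.cons_val, inv_pow]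
    push_cast; ring
  · rw [vortexFieldDeriv, sum_erase_two, e20, e21, neg_sq, neg_sq]
    simp only [intensity, Matrix.cons_val_zero, Matrix.cons_val_one, inv_pow]
    push_cast; ring

/-- The weights `-1, 2, 2` are proportional to the intensities. Weighted sums of the burst relations
cancel by antisymmetry in the first case, and reduce to `∑_{j<k} ξ_j ξ_k = 0` in the second. -/
theorem moments (h : IsBurstParam ξ a b α) :
    -conj (α 0) + 2 * conj (α 1) + 2 * conj (α 2) = 0 ∧
      -(α 0 * conj (α 0)) + 2 * (α 1 * conj (α 1)) + 2 * (α 2 * conj (α 2)) = 0 := by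
  obtain ⟨p, q, r, ⟨hp, hq, hr⟩, ⟨r0, r1, r2⟩, -⟩ := h.exists_inverses
  have hc : (2 * Real.pi * I * (a - I * b) : ℂ) ≠ 0 :=
    mul_ne_zero two_pi_mul_I_ne_zero h.rate_ne_zero
  constructor
  · refine (mul_eq_zero.1 ?_).resolve_left hc
    linear_combination r0 - 2 * r1 - 2 * r2
  · refine (mul_eq_zero.1 ?_).resolve_left hc
    linear_combination α 0 * r0 - 2 * α 1 * r1 - 2 * α 2 * r2 - 2 / 3 * ξ * hp - 2 / 3 * ξ * hq
      + 4 / 3 * ξ * hr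

/-- If one `α j` vanishes, the first moment makes the other two proportional. The second moment then
forces them to vanish too, against distinctness. -/
theorem ne_zero (h : IsBurstParam ξ a b α) (j : Fin 3) : α j ≠ 0 := by
  obtain ⟨h1, h2⟩ := h.moments
  have h1' : -α 0 + 2 * α 1 + 2 * α 2 = 0 := by simpa [map_ofNat] using congrArg conj h1
  have d01 := h.sub_ne_zero (show (0 : Fin 3) ≠ 1 by decide)
  have d02 := h.sub_ne_zero (show (0 : Fin 3) ≠ 2 by decide)
  have d12 := h.sub_ne_zero (show (1 : Fin 3) ≠ 2 by decide)
  have key : ∀ w : ℂ, w * conj w = 0 → w = 0 := fun w hw => by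
    rw [mul_conj] at hw
    exact normSq_eq_zero.1 (by exact_mod_cast hw)
  intro hj
  fin_cases j
  · have h0 : α 0 = 0 := hj
    have h21 : α 2 = -α 1 := by linear_combination h1' / 2 + h0 / 2
    have : α 1 = 0 := key _ (by rw [h0, h21] at h2; simp at h2; simpa [or_comm] using h2)
    exact d01 (by rw [h0, this, sub_zero])
  · have h0 : α 1 = 0 := hj
    have h21 : α 0 = 2 * α 2 := by linear_combination -h1' + 2 * h0
    have : α 2 = 0 := key _ (by
      rw [h0, h21] at h2
      simp only [map_mul, map_ofNat, map_zero] at h2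
      linear_combination -h2 / 2)
    exact d12 (by rw [h0, this, sub_zero])
  · have h0 : α 2 = 0 := hj
    have h21 : α 0 = 2 * α 1 := by linear_combination -h1' + 2 * h0
    have : α 1 = 0 := key _ (by
      rw [h0, h21] at h2
      simp only [map_mul, map_ofNat, map_zero] at h2
      linear_combination -h2 / 2)
    exact d12 (by rw [h0, this, sub_zero])

/-- The first two moments, weighted with the intensities, determine a vector up to a multiple of
`conj α`. -/
theorem eq_mul_conj (h : IsBurstParam ξ a b α) {x : Fin 3 → ℂ}
    (h0 : -x 0 + 2 * x 1 + 2 * x 2 = 0)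
    (h1 : -(α 0 * x 0) + 2 * (α 1 * x 1) + 2 * (α 2 * x 2) = 0) (j : Fin 3) :
    x j = x 0 / conj (α 0) * conj (α j) := by
  -- The two conditions are independent since `α 1 ≠ α 2`, and `conj α` satisfies both, so it spans
  -- their solutions.
  obtain ⟨m0, m1⟩ := h.moments
  have hα : conj (α 0) ≠ 0 := by simpa using h.ne_zero 0
  have d12 := h.sub_ne_zero (show (1 : Fin 3) ≠ 2 by decide)
  have ht : x 0 / conj (α 0) * conj (α 0) = x 0 := div_mul_cancel₀ _ hα
  set t := x 0 / conj (α 0)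
  have k1 : (α 1 - α 2) * (x 1 - t * conj (α 1)) = 0 := by
    linear_combination h1 / 2 - t * m1 / 2 - α 2 * h0 / 2 + α 2 * t * m0 / 2
      + (α 2 - α 0) / 2 * ht
  have k2 : (α 1 - α 2) * (x 2 - t * conj (α 2)) = 0 := by
    linear_combination α 1 / 2 * h0 - α 1 * t * m0 / 2 - h1 / 2 + t * m1 / 2
      + (α 0 - α 1) / 2 * ht
  have k1' := (mul_eq_zero.1 k1).resolve_left d12
  have k2' := (mul_eq_zero.1 k2).resolve_left d12
  fin_cases j
  · exact ht.symm
  · exact sub_eq_zero.1 k1'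
  · exact sub_eq_zero.1 k2'

/-- A direction complementing the translations and the multiples of `α`, along which the
linearised field is explicit. -/
theorem exists_direction (h : IsBurstParam ξ a b α) : ∃ (e : Fin 3 → ℂ) (θ : ℂ),
    -e 0 + 2 * e 1 + 2 * e 2 = 0 ∧
    -(conj (α 0) * e 0) + 2 * (conj (α 1) * e 1) + 2 * (conj (α 2) * e 2) = 1 ∧
    ∀ j, conj (vortexFieldDeriv ξ α e j) = -(a + I * b) * e j + θ * α j := by
  obtain ⟨p, q, r, ⟨hp, hq, hr⟩, ⟨r0, r1, r2⟩, hA⟩ := h.exists_inverses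
  have d12 := h.sub_ne_zero (show (1 : Fin 3) ≠ 2 by decide)
  -- With `e = (0, l, -l)` the first moment vanishes, and this `l` normalises the pairing with `conj
  -- α` to one.
  let l : ℂ := conj (r / 2)
  have hl : l * (2 * (conj (α 1) - conj (α 2))) = 1 := by
    have := congrArg conj hr
    simp only [map_mul, map_sub, map_one] at this
    simp only [l, map_div₀, map_ofNat]
    linear_combination this
  let e : Fin 3 → ℂ := ![0, l, -l]
  have e0 : e 0 = 0 := rfl
  have e1 : e 1 = l := rfl
  have e2 : e 2 = -l := rfl
  obtain ⟨A0, A1, A2⟩ := hA e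
  have hD := two_pi_mul_I_ne_zero
  -- Both moments of `x` vanish: the first by antisymmetry, the second because `∑ ξ_j z_j F_j(z)` is
  -- constant for the vortex field `F`, and its derivative along `e` cancels the pairing of `α` with
  -- `conj e`.
  let x : Fin 3 → ℂ := fun j => vortexFieldDeriv ξ α e j + (a - I * b) * conj (e j)
  have hD' : 1 / (2 * Real.pi * I : ℂ) * (2 * Real.pi * I) = 1 := one_div_mul_cancel hD
  set D : ℂ := 1 / (2 * Real.pi * I)
  have hr' : conj l = r / 2 := by simp [l]
  have hx := h.eq_mul_conj (x := x)
    (by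
      simp only [x, A0, A1, A2, e0, e1, e2, map_neg, map_zero]
      ring)
    (by
      simp only [x, A0, A1, A2, e0, e1, e2, map_neg, map_zero, hr']
      linear_combination D * l * ξ * (-2 / 3 * p * hp + 2 / 3 * q * hq - 8 / 3 * r * hr)
        - 2 * D * l * r1 + 2 * D * l * r2 - (a - I * b) * hl + (a - I * b) * hr
        - 2 * l * (conj (α 1) - conj (α 2)) * (a - I * b) * hD')
  refine ⟨e, conj (x 0 / conj (α 0)), by simp [e0, e1, e2],
    by rw [e0, e1, e2]; linear_combination hl, fun j => ?_⟩
  have := congrArg conj (hx j)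
  simp only [x, map_add, map_mul, map_sub, conj_ofReal, conj_I, conj_conj] at this
  linear_combination this

end IsBurstParam

/-! ### Dissipative coordinates for the linearised profile equation. -/

/-- The real-linear map `w ↦ 2 κ Re w + i Im w`. -/
noncomputable def shear (a b : ℝ) : ℂ →L[ℝ] ℂ :=
  reCLM.smulRight (2 * burstRate a b) + imCLM.smulRight I

theorem shear_apply (w : ℂ) : shear a b w = w.re * (2 * burstRate a b) + w.im * I := by
  simp [shear]

theorem two_mul_burstRate (ha : 0 < a) : 2 * burstRate a b = 1 + I * (b / a : ℝ) := by
  have : (a : ℂ) ≠ 0 := by exact_mod_cast ha.ne'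
  rw [burstRate]
  push_cast
  field_simp

theorem shear_re (ha : 0 < a) (w : ℂ) : (shear a b w).re = w.re := by
  rw [shear_apply, two_mul_burstRate ha]
  simp

theorem shear_im (ha : 0 < a) (w : ℂ) : (shear a b w).im = w.re * (b / a) + w.im := by
  rw [shear_apply, two_mul_burstRate ha]
  simp

/-- The inverse of `shear`. -/
noncomputable def unshear (a b : ℝ) : ℂ →L[ℝ] ℂ :=
  ContinuousLinearMap.id ℝ ℂ - reCLM.smulRight ((b / a : ℝ) * I)

theorem shear_unshear (ha : 0 < a) (w : ℂ) : shear a b (unshear a b w) = w := by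
  apply Complex.ext
  · rw [shear_re ha]; simp [unshear]
  · rw [shear_im ha]; simp [unshear]

theorem shear_injective (ha : 0 < a) {w : ℂ} (h : shear a b w = 0) : w = 0 := by
  have h1 := shear_re ha (b := b) w
  have h2 := shear_im ha (b := b) w
  rw [h] at h1 h2
  apply Complex.ext
  · simpa using h1.symm
  · simpa [← h1] using h2.symm

/-- The right-hand side of the equation in self-similar variables and logarithmic time, without
external field. -/
noncomputable def profileField (ξ a b : ℝ) (α u : Fin 3 → ℂ) (j : Fin 3) : ℂ :=
  (2 * a : ℂ)⁻¹ * conj (vortexField ξ (α + u) j) - burstRate a b * (α j + u j)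

/-- The derivative of `profileField` at `0`. -/
noncomputable def profileDeriv (ξ a b : ℝ) (α : Fin 3 → ℂ) : (Fin 3 → ℂ) →L[ℝ] (Fin 3 → ℂ) :=
  ContinuousLinearMap.pi fun j =>
    (2 * a : ℂ)⁻¹ • (conjCLE : ℂ →L[ℝ] ℂ).comp ((1 / (2 * Real.pi * I) : ℂ) •
      ∑ k ∈ Finset.univ.erase j, (-(intensity ξ k : ℂ) / (α j - α k) ^ 2) •
        (ContinuousLinearMap.proj (R := ℝ) (φ := fun _ : Fin 3 => ℂ) j -
          ContinuousLinearMap.proj k)) -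
    burstRate a b • ContinuousLinearMap.proj j

theorem profileDeriv_apply (v : Fin 3 → ℂ) (j : Fin 3) : profileDeriv ξ a b α v j =
    (2 * a : ℂ)⁻¹ * conj (vortexFieldDeriv ξ α v j) - burstRate a b * v j := by
  simp [profileDeriv, vortexFieldDeriv]

namespace IsBurstParam

theorem profileField_zero (h : IsBurstParam ξ a b α) : profileField ξ a b α 0 = 0 := by
  funext j
  have : (a : ℂ) ≠ 0 := by exact_mod_cast h.pos.ne'
  rw [profileField, add_zero, h.vortexField_eq, burstRate]
  simp
  field_simp
  ring

theorem hasStrictFDerivAt_profileField (h : IsBurstParam ξ a b α) :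
    HasStrictFDerivAt (profileField ξ a b α) (profileDeriv ξ a b α) 0 := by
  rw [hasStrictFDerivAt_pi']
  intro j
  have hp : ∀ k : Fin 3, HasStrictFDerivAt (fun u : Fin 3 → ℂ => u k)
      (ContinuousLinearMap.proj (R := ℝ) (φ := fun _ : Fin 3 => ℂ) k) 0 := fun k =>
    (ContinuousLinearMap.proj (R := ℝ) (φ := fun _ : Fin 3 => ℂ) k).hasStrictFDerivAt
  have hk : ∀ k ∈ Finset.univ.erase j, HasStrictFDerivAt
      (fun u : Fin 3 → ℂ => (intensity ξ k : ℂ) / ((α + u) j - (α + u) k))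
      ((-(intensity ξ k : ℂ) / (α j - α k) ^ 2) •
        (ContinuousLinearMap.proj (R := ℝ) (φ := fun _ : Fin 3 => ℂ) j -
          ContinuousLinearMap.proj k)) 0 := by
    intro k hk
    have h1 := ((hp j).const_add (α j)).sub ((hp k).const_add (α k))
    have hne : (fun u : Fin 3 → ℂ => α j + u j - (α k + u k)) 0 ≠ 0 := by
      simpa using h.sub_ne_zero (Finset.ne_of_mem_erase hk).symm
    have h2 := (((hasStrictDerivAt_inv hne).const_mul
      (intensity ξ k : ℂ)).hasStrictFDerivAt.restrictScalars ℝ).comp 0 h1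
    refine h2.congr_fderiv ?_
    ext v
    simp
    ring
  have h3 := (conjCLE : ℂ →L[ℝ] ℂ).hasStrictFDerivAt.comp 0
    ((HasStrictFDerivAt.fun_sum hk).const_smul (1 / (2 * Real.pi * I) : ℂ))
  exact (h3.const_smul (2 * a : ℂ)⁻¹).sub (((hp j).const_add (α j)).const_smul (burstRate a b))

/-- In suitable coordinates the linearised equation, shifted by `-1/4`, is dissipative. -/
theorem exists_dissipative_coordinates (h : IsBurstParam ξ a b α) :
    ∃ (Ψ : (Fin 3 → ℂ) ≃L[ℝ] (Fin 3 → ℂ)) (η q : ℝ), 0 < η ∧ 0 ≤ q ∧ q < 1 ∧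
      ∀ y, ‖y + η • (Ψ.symm (profileDeriv ξ a b α (Ψ y)) - (1 / 4 : ℝ) • y)‖ ≤ q * ‖y‖ := by
  obtain ⟨e, θ, he0, he1, heA⟩ := h.exists_direction
  obtain ⟨hm0, hm1⟩ := h.moments
  have ha := h.pos
  have ha' : (a : ℂ) ≠ 0 := by exact_mod_cast ha.ne'
  let l : ℂ →L[ℝ] ℂ := (unshear a b).comp (((2 * a : ℂ)⁻¹ * θ) •
    ((conjCLE : ℂ →L[ℝ] ℂ).comp (shear a b)))
  have hl : ∀ w, shear a b (l w) = (2 * a : ℂ)⁻¹ * θ * conj (shear a b w) := fun w => by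
    simp only [l, ContinuousLinearMap.comp_apply, shear_unshear ha]
    simp
  obtain ⟨C, hC0, hC⟩ : ∃ C > 0, ∀ w, ‖l w‖ ≤ C * ‖w‖ := l.bound
  -- Stretching the `α` direction by `ε⁻¹` shrinks the coupling `l` from the `e` direction to norm
  -- at most `1/8`.
  let ε : ℝ := 1 / (8 * C)
  have hε0 : 0 < ε := by positivity
  have hεC : ε * C = 1 / 8 := by simp only [ε]; field_simp
  have hε' : (ε : ℂ) ≠ 0 := by exact_mod_cast hε0.ne'
  let Λ : (Fin 3 → ℂ) →ₗ[ℝ] (Fin 3 → ℂ) :=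
    { toFun := fun y j => y 0 + shear a b (y 1) * e j + (ε : ℂ)⁻¹ * shear a b (y 2) * α j
      map_add' := fun x y => by
        funext j
        simp only [Pi.add_apply, map_add]
        ring
      map_smul' := fun c y => by
        funext j
        simp only [Pi.smul_apply, map_smul]
        simp only [real_smul, RingHom.id_apply]
        ring }
  have hΛ : ∀ y j, Λ y j =
    y 0 + shear a b (y 1) * e j + (ε : ℂ)⁻¹ * shear a b (y 2) * α j := fun _ _ => rfl
  have hinj : Function.Injective Λ := by
    rw [← LinearMap.ker_eq_bot, LinearMap.ker_eq_bot']
    intro y hy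
    have hy' : ∀ j, y 0 + shear a b (y 1) * e j + (ε : ℂ)⁻¹ * shear a b (y 2) * α j = 0 :=
      fun j => congrFun hy j
    have hm0' : -α 0 + 2 * α 1 + 2 * α 2 = 0 := by simpa [map_ofNat] using congrArg conj hm0
    -- The first moment isolates `y 0`, as the weights sum to `3` and annihilate `e` and `α`.
    -- Pairing with `conj α` then isolates `y 1`.
    have y0 : y 0 = 0 := by
      linear_combination (-hy' 0 + 2 * hy' 1 + 2 * hy' 2 - shear a b (y 1) * he0
        - (ε : ℂ)⁻¹ * shear a b (y 2) * hm0') / 3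
    have y1 : y 1 = 0 := shear_injective (a := a) (b := b) ha (by
      linear_combination -conj (α 0) * hy' 0 + 2 * conj (α 1) * hy' 1 + 2 * conj (α 2) * hy' 2
        - shear a b (y 1) * he1 - y 0 * hm0 - (ε : ℂ)⁻¹ * shear a b (y 2) * hm1)
    have y2 : y 2 = 0 := shear_injective (a := a) (b := b) ha (by
      have := hy' 0
      rw [y0, y1, map_zero, zero_mul, zero_add, zero_add, mul_assoc] at this
      exact (mul_eq_zero.1 ((mul_eq_zero.1 this).resolve_left (inv_ne_zero hε'))).resolve_right
        (h.ne_zero 0))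
    funext j
    fin_cases j
    exacts [y0, y1, y2]
  let Ψ : (Fin 3 → ℂ) ≃L[ℝ] (Fin 3 → ℂ) :=
    (LinearEquiv.ofInjectiveEndo Λ hinj).toContinuousLinearEquiv
  have hΨ : ∀ y, Ψ y = Λ y := fun _ => rfl
  let κ := burstRate a b
  -- The linearisation in the new coordinates: `shear` conjugates `w ↦ -2 κ Re w` to `w ↦ -Re w`,
  -- and `θ` leaves only the small triangular term.
  let B : (Fin 3 → ℂ) → Fin 3 → ℂ := fun y =>
    ![-κ * y 0, -((y 1).re : ℂ), -((y 2).re : ℂ) + ε * l (y 1)]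
  have hκ : (2 * a : ℂ)⁻¹ * (a + I * b) = κ := by
    simp only [κ, burstRate]; field_simp
  have hκ' : (2 * a : ℂ)⁻¹ * conj (a - I * b : ℂ) = κ := by
    rw [← hκ]; simp
  have hB : ∀ y, profileDeriv ξ a b α (Ψ y) = Ψ (B y) := by
    intro y
    funext j
    have e1 : vortexFieldDeriv ξ α (Ψ y) j = shear a b (y 1) * vortexFieldDeriv ξ α e j +
        (ε : ℂ)⁻¹ * shear a b (y 2) * vortexFieldDeriv ξ α α j := by
      simp only [vortexFieldDeriv, hΨ, hΛ, Finset.mul_sum, ← Finset.sum_add_distrib]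
      refine Finset.sum_congr rfl fun k _ => ?_
      ring
    have hre : ∀ w, shear a b w + conj (shear a b w) = 2 * (w.re : ℂ) := fun w => by
      rw [add_conj, shear_re ha]; push_cast; rfl
    have hsre : ∀ w : ℂ, shear a b (-(w.re : ℂ)) = -(2 * κ * w.re) := fun w => by
      rw [shear_apply]; simp [κ]; ring
    have b0 : B y 0 = -κ * y 0 := rfl
    have b1 : B y 1 = -((y 1).re : ℂ) := rfl
    have b2 : B y 2 = -((y 2).re : ℂ) + ε * l (y 1) := rfl
    have hsl : shear a b (ε * l (y 1)) = ε * ((2 * a : ℂ)⁻¹ * θ * conj (shear a b (y 1))) := by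
      rw [← hl, ← real_smul, map_smul, real_smul]
    rw [profileDeriv_apply, e1, map_add, map_mul, heA, h.vortexFieldDeriv_self, hΨ, hΨ, hΛ, hΛ,
      b0, b1, b2, map_add, hsre, hsre, hsl]
    simp only [map_mul, map_neg, map_inv₀, conj_ofReal, conj_conj]
    have h1 := hre (y 1)
    have h2 := hre (y 2)
    have hεε : (ε : ℂ)⁻¹ * ε = 1 := inv_mul_cancel₀ hε'
    change _ - κ * _ = _
    linear_combination -(conj (shear a b (y 1)) * e j) * hκ - κ * e j * h1
      - (ε : ℂ)⁻¹ * conj (shear a b (y 2)) * α j * hκ' - (ε : ℂ)⁻¹ * κ * α j * h2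
      - (2 * a : ℂ)⁻¹ * θ * conj (shear a b (y 1)) * α j * hεε
  let β : ℝ := b / (2 * a)
  have hκβ : κ = 1 / 2 + I * β := by
    simp only [κ, burstRate, β]; push_cast; field_simp
  -- The step must be short enough that the rotation `β` in `κ`, which costs order `η ^ 2`, does not
  -- outweigh the damping of order `η`.
  let η : ℝ := 1 / (2 * (1 + β ^ 2))
  have hη0 : 0 < η := by positivity
  have hηβ : η * (1 + β ^ 2) = 1 / 2 := by simp only [η]; field_simp
  have hη1 : η ≤ 1 / 2 := by nlinarith [sq_nonneg β]
  have hnorm_re : ∀ w : ℂ, ‖w + η * (-(w.re : ℂ) - 1 / 4 * w)‖ ≤ (1 - η / 4) * ‖w‖ := by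
    intro w
    rw [← sq_le_sq₀ (norm_nonneg _) (mul_nonneg (by linarith) (norm_nonneg _)), mul_pow,
      ← normSq_eq_norm_sq, ← normSq_eq_norm_sq, normSq_apply, normSq_apply]
    simp
    nlinarith [mul_nonneg (mul_nonneg hη0.le (show 0 ≤ 2 * (1 - η / 4) - η by linarith))
      (mul_self_nonneg w.re)]
  have hnorm_κ : ∀ w : ℂ, ‖w + η * (-κ * w - 1 / 4 * w)‖ ≤ (1 - η / 4) * ‖w‖ := by
    intro w
    have : w + η * (-κ * w - 1 / 4 * w) = (1 + η * (-κ - 1 / 4)) * w := by ring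
    rw [this, norm_mul]
    refine mul_le_mul_of_nonneg_right ?_ (norm_nonneg _)
    rw [← sq_le_sq₀ (norm_nonneg _) (by linarith), ← normSq_eq_norm_sq, normSq_apply, hκβ]
    simp
    nlinarith [mul_nonneg hη0.le (show 0 ≤ (1 - η / 2) - η * β ^ 2 by nlinarith)]
  -- Each diagonal block contracts by `1 - η / 4`; the coupling gives back at most `η / 8`.
  refine ⟨Ψ, η, 1 - η / 8, hη0, by linarith, by linarith, fun y => ?_⟩
  rw [hB, ContinuousLinearEquiv.symm_apply_apply, pi_norm_le_iff_of_nonneg (by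
    have := norm_nonneg y
    have : 0 ≤ 1 - η / 8 := by linarith
    positivity)]
  have hy := norm_le_pi_norm y
  have hq : ∀ j, (1 - η / 4) * ‖y j‖ ≤ (1 - η / 4) * ‖y‖ := fun j =>
    mul_le_mul_of_nonneg_left (hy j) (by linarith)
  have hηy : 0 ≤ η * ‖y‖ := by positivity
  have hBj : ∀ j, (y + η • (B y - (1 / 4 : ℝ) • y)) j = y j + η * (B y j - 1 / 4 * y j) :=
    fun j => by
      simp only [Pi.add_apply, Pi.smul_apply, Pi.sub_apply, real_smul]
      push_cast
      rfl
  intro j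
  fin_cases j
  · have := hnorm_κ (y 0)
    have e1 : (y + η • (B y - (1 / 4 : ℝ) • y)) 0 = y 0 + η * (-κ * y 0 - 1 / 4 * y 0) :=
      hBj 0
    change ‖(y + η • (B y - (1 / 4 : ℝ) • y)) 0‖ ≤ _
    rw [e1]
    linarith [hq 0]
  · have := hnorm_re (y 1)
    have e1 : (y + η • (B y - (1 / 4 : ℝ) • y)) 1 =
        y 1 + η * (-((y 1).re : ℂ) - 1 / 4 * y 1) := hBj 1
    change ‖(y + η • (B y - (1 / 4 : ℝ) • y)) 1‖ ≤ _
    rw [e1]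
    linarith [hq 1]
  · have h1 := hnorm_re (y 2)
    have e1 : (y + η • (B y - (1 / 4 : ℝ) • y)) 2 =
        (y 2 + η * (-((y 2).re : ℂ) - 1 / 4 * y 2)) + (η * ε : ℝ) * l (y 1) := by
      rw [hBj, show B y 2 = -((y 2).re : ℂ) + ε * l (y 1) from rfl]
      push_cast
      ring
    change ‖(y + η • (B y - (1 / 4 : ℝ) • y)) 2‖ ≤ _
    rw [e1]
    have h2 : ‖((η * ε : ℝ) : ℂ) * l (y 1)‖ ≤ η / 8 * ‖y‖ := by
      rw [norm_mul, Complex.norm_real, Real.norm_of_nonneg (by positivity)]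
      calc η * ε * ‖l (y 1)‖ ≤ η * ε * (C * ‖y‖) := by
            gcongr
            exact (hC _).trans (mul_le_mul_of_nonneg_left (hy 1) hC0.le)
        _ = η * (ε * C) * ‖y‖ := by ring
        _ = _ := by rw [hεC]; ring
    linarith [norm_add_le (y 2 + η * (-((y 2).re : ℂ) - 1 / 4 * y 2)) ((η * ε : ℝ) * l (y 1)),
      hq 2]

end IsBurstParam
-- Pointwise bounds and joint continuity of the external field.
section ExternalField

variable {T M : ℝ} {f : ℝ → ℂ → ℂ}

theorem enorm_iteratedFDeriv_le_of_normE_le (hf : normE T f ≤ ENNReal.ofReal M) {t : ℝ}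
    (ht : t ∈ Ico 0 T) {i : ℕ} (hi : i < 3) (p : ℂ) :
    ‖iteratedFDeriv ℝ i (f t) p‖ₑ ≤ ENNReal.ofReal M :=
  calc ‖iteratedFDeriv ℝ i (f t) p‖ₑ ≤ ⨆ p : ℂ, ‖iteratedFDeriv ℝ i (f t) p‖ₑ :=
        le_iSup (fun p : ℂ => ‖iteratedFDeriv ℝ i (f t) p‖ₑ) p
    _ ≤ ckNorm 2 (f t) :=
        Finset.single_le_sum (f := fun i => ⨆ p : ℂ, ‖iteratedFDeriv ℝ i (f t) p‖ₑ)
          (fun _ _ => zero_le) (Finset.mem_range.2 hi)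
    _ ≤ ⨆ t ∈ Ico 0 T, ckNorm 2 (f t) := le_iSup₂ (f := fun t _ => ckNorm 2 (f t)) t ht
    _ ≤ normE T f := le_self_add
    _ ≤ _ := hf

theorem norm_iteratedFDeriv_le_of_normE_le (hM : 0 ≤ M) (hf : normE T f ≤ ENNReal.ofReal M)
    {t : ℝ} (ht : t ∈ Ico 0 T) {i : ℕ} (hi : i < 3) (p : ℂ) :
    ‖iteratedFDeriv ℝ i (f t) p‖ ≤ M := by
  have h := enorm_iteratedFDeriv_le_of_normE_le hf ht hi p
  rwa [← ofReal_norm, ENNReal.ofReal_le_ofReal_iff hM] at h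

theorem norm_le_of_normE_le (hM : 0 ≤ M) (hf : normE T f ≤ ENNReal.ofReal M) {t : ℝ}
    (ht : t ∈ Ico 0 T) (p : ℂ) : ‖f t p‖ ≤ M := by
  simpa using norm_iteratedFDeriv_le_of_normE_le hM hf ht (i := 0) (by norm_num) p

theorem norm_sub_le_of_normE_le (hM : 0 ≤ M) (hE : MemE T f)
    (hf : normE T f ≤ ENNReal.ofReal M) {t : ℝ} (ht : t ∈ Ico 0 T) (p q : ℂ) :
    ‖f t p - f t q‖ ≤ M * ‖p - q‖ := by
  refine convex_univ.norm_image_sub_le_of_norm_fderiv_le (𝕜 := ℝ)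
    (fun x _ => ((hE.contDiff t ht).differentiable (by norm_num)).differentiableAt)
    (fun x _ => ?_) (mem_univ q) (mem_univ p)
  rw [← norm_iteratedFDeriv_one]
  exact norm_iteratedFDeriv_le_of_normE_le hM hf ht (by norm_num) x

theorem norm_time_sub_le_of_normE_le (hM : 0 ≤ M) (hf : normE T f ≤ ENNReal.ofReal M)
    {s t : ℝ} (hs : s ∈ Ico 0 T) (ht : t ∈ Ico 0 T) (p : ℂ) :
    ‖f t p - f s p‖ ≤ M * |t - s| := by
  rcases eq_or_ne s t with rfl | hst
  · simp
  have h : ‖f t p - f s p‖ₑ / ENNReal.ofReal |t - s| ≤ ENNReal.ofReal M :=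
    calc ‖f t p - f s p‖ₑ / ENNReal.ofReal |t - s|
        ≤ supNorm (f t - f s) / ENNReal.ofReal |t - s| := by
          gcongr
          exact le_iSup (fun p : ℂ => ‖(f t - f s) p‖ₑ) p
      _ ≤ lipSeminorm T f := le_iSup_of_le s <| le_iSup_of_le hs <| le_iSup_of_le t <|
          le_iSup_of_le ht <| le_iSup_of_le hst le_rfl
      _ ≤ normE T f := le_add_self
      _ ≤ _ := hf
  have h0 : 0 < |t - s| := abs_pos.2 (sub_ne_zero.2 hst.symm)
  rw [ENNReal.div_le_iff (by simpa using h0) ENNReal.ofReal_ne_top, ← ENNReal.ofReal_mul hM,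
    ← ofReal_norm, ENNReal.ofReal_le_ofReal_iff (by positivity)] at h
  exact h

theorem continuousOn_of_normE_le (hM : 0 ≤ M) (hE : MemE T f)
    (hf : normE T f ≤ ENNReal.ofReal M) :
    ContinuousOn (Function.uncurry f) (Ioo 0 T ×ˢ univ) := by
  intro x hx
  have hx1 : x.1 ∈ Ico 0 T := Ioo_subset_Ico_self hx.1
  rw [ContinuousWithinAt, tendsto_iff_norm_sub_tendsto_zero]
  have hlim : Tendsto (fun y : ℝ × ℂ => M * |y.1 - x.1| + M * ‖y.2 - x.2‖)
      (𝓝[Ioo 0 T ×ˢ univ] x) (𝓝 0) := by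
    have : Continuous fun y : ℝ × ℂ => M * |y.1 - x.1| + M * ‖y.2 - x.2‖ := by fun_prop
    simpa using this.continuousWithinAt (s := Ioo 0 T ×ˢ univ) (x := x) |>.tendsto
  refine squeeze_zero' (Eventually.of_forall fun _ => norm_nonneg _) ?_ hlim
  filter_upwards [self_mem_nhdsWithin] with y hy
  have e : Function.uncurry f y - Function.uncurry f x =
      (f y.1 y.2 - f x.1 y.2) + (f x.1 y.2 - f x.1 x.2) := by
    simp [Function.uncurry]
  rw [e]
  exact (norm_add_le _ _).trans (add_le_add
    (norm_time_sub_le_of_normE_le hM hf hx1 (Ioo_subset_Ico_self hy.1) _)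
    (norm_sub_le_of_normE_le hM hE hf hx1 _ _))

end ExternalField

/-! ### The self-similar factor. -/

section SelfSimilar

theorem norm_selfSimilar (t : ℝ) : ‖selfSimilar a b t‖ = √(2 * a * t) := by
  rw [selfSimilar, norm_mul, mul_comm I, norm_exp_ofReal_mul_I, mul_one, Complex.norm_real,
    Real.norm_of_nonneg (Real.sqrt_nonneg _)]

theorem selfSimilar_mul_conj (ha : 0 < a) {t : ℝ} (ht : 0 < t) :
    selfSimilar a b t * conj (selfSimilar a b t) = 2 * a * t := by
  rw [mul_conj, normSq_eq_norm_sq, norm_selfSimilar, Real.sq_sqrt (by positivity)]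
  push_cast
  rfl

theorem selfSimilar_ne_zero (ha : 0 < a) {t : ℝ} (ht : 0 < t) : selfSimilar a b t ≠ 0 := by
  rw [← norm_pos_iff, norm_selfSimilar]
  exact Real.sqrt_pos.2 (by positivity)

theorem hasDerivAt_selfSimilar (ha : 0 < a) {t : ℝ} (ht : 0 < t) :
    HasDerivAt (selfSimilar a b) (selfSimilar a b t * burstRate a b / t) t := by
  have h1 : HasDerivAt (fun t : ℝ => ((√(2 * a * t) : ℝ) : ℂ))
      ((2 * a * 1 / (2 * √(2 * a * t)) : ℝ) : ℂ) t :=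
    (((hasDerivAt_id t).const_mul (2 * a)).sqrt (show 2 * a * t ≠ 0 by positivity)).ofReal_comp
  have h2 : HasDerivAt (fun t : ℝ => ((b / (2 * a) * Real.log t : ℝ) : ℂ))
      ((b / (2 * a) * t⁻¹ : ℝ) : ℂ) t :=
    ((Real.hasDerivAt_log ht.ne').const_mul (b / (2 * a))).ofReal_comp
  have h3 := h1.mul ((h2.const_mul I).cexp)
  refine h3.congr_deriv ?_
  have hs : 0 < √(2 * a * t) := by positivity
  have hsq : ((√(2 * a * t) : ℝ) : ℂ) * (√(2 * a * t) : ℝ) = 2 * a * t := by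
    rw [← ofReal_mul, Real.mul_self_sqrt (by positivity)]
    push_cast
    rfl
  have hs' : ((√(2 * a * t) : ℝ) : ℂ) ≠ 0 := by exact_mod_cast hs.ne'
  have ha' : (a : ℂ) ≠ 0 := by exact_mod_cast ha.ne'
  have ht' : (t : ℂ) ≠ 0 := by exact_mod_cast ht.ne'
  have e1 : ((2 * a * 1 / (2 * √(2 * a * t)) : ℝ) : ℂ) = (√(2 * a * t) : ℝ) / (2 * t) := by
    push_cast
    rw [div_eq_div_iff (by simpa using hs') (by simpa using ht')]
    linear_combination -2 * hsq
  rw [e1, selfSimilar, burstRate]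
  push_cast
  field_simp

theorem contDiffOn_selfSimilar (ha : 0 < a) {T : ℝ} :
    ContDiffOn ℝ 1 (selfSimilar a b) (Ioo 0 T) := by
  intro t ht
  have ht0 : t ≠ 0 := ht.1.ne'
  have h1 : ContDiffAt ℝ 1 (fun t : ℝ => √(2 * a * t)) t :=
    (contDiffAt_const.mul contDiffAt_id).sqrt (by
      have := ht.1
      simp only [id]
      positivity)
  have h2 : ContDiffAt ℝ 1 (fun t : ℝ => b / (2 * a) * Real.log t) t :=
    contDiffAt_const.mul (Real.contDiffAt_log.2 ht0)
  have h3 : ContDiffAt ℝ 1 (fun t : ℝ => ((√(2 * a * t) : ℝ) : ℂ)) t :=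
    ofRealCLM.contDiff.contDiffAt.comp t h1
  have h4 : ContDiffAt ℝ 1 (fun t : ℝ => ((b / (2 * a) * Real.log t : ℝ) : ℂ)) t :=
    ofRealCLM.contDiff.contDiffAt.comp t h2
  exact (h3.mul (contDiffAt_const.mul h4).cexp).contDiffWithinAt

end SelfSimilar

/-! ### Estimates of the half-Hölder seminorm. -/

section Holder

/-- Integrating `K / √r` gives `2 K (√t - √s)`, and the square root is subadditive. -/
theorem norm_sub_le_two_mul_sqrt {E : Type*} [NormedAddCommGroup E] [NormedSpace ℝ E]
    {x x' : ℝ → E} {T K : ℝ} (hK : 0 ≤ K) (hx : ∀ t ∈ Ioo 0 T, HasDerivAt x (x' t) t)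
    (hb : ∀ t ∈ Ioo 0 T, ‖x' t‖ ≤ K / √t) {s t : ℝ} (hs : s ∈ Ioo 0 T) (ht : t ∈ Ioo 0 T)
    (hst : s ≤ t) : ‖x t - x s‖ ≤ 2 * K * √(t - s) := by
  have hsub : ∀ r ∈ Icc s t, r ∈ Ioo 0 T := fun r hr =>
    ⟨hs.1.trans_le hr.1, hr.2.trans_lt ht.2⟩
  have hB : ∀ r ∈ Icc s t, HasDerivAt (fun r => 2 * K * (√r - √s)) (K / √r) r := by
    intro r hr
    have hr0 := (hsub r hr).1
    refine (((Real.hasDerivAt_sqrt hr0.ne').sub_const (√s)).const_mul (2 * K)).congr_deriv ?_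
    have := Real.sqrt_pos.2 hr0
    field_simp
  have h := image_norm_le_of_norm_deriv_right_le_deriv_boundary' (f := fun r => x r - x s)
    (f' := x') (a := s) (b := t) (B := fun r => 2 * K * (√r - √s)) (B' := fun r => K / √r)
    (fun r hr => ((hx r (hsub r hr)).sub_const (x s)).continuousAt.continuousWithinAt)
    (fun r hr => ((hx r (hsub r (Ico_subset_Icc_self hr))).sub_const (x s)).hasDerivWithinAt)
    (by simp)
    (fun r hr => (hB r hr).continuousAt.continuousWithinAt)
    (fun r hr => (hB r (Ico_subset_Icc_self hr)).hasDerivWithinAt)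
    (fun r hr => hb r (hsub r (Ico_subset_Icc_self hr))) ⟨hst, le_rfl⟩
  refine h.trans ?_
  gcongr
  rw [sub_le_iff_le_add]
  calc √t = √((t - s) + s) := by ring_nf
    _ ≤ √(t - s) + √s := by
      rw [Real.sqrt_le_left (by positivity), add_sq, Real.sq_sqrt (sub_nonneg.2 hst),
        Real.sq_sqrt hs.1.le]
      have : 0 ≤ 2 * √(t - s) * √s := by positivity
      linarith

theorem halfHolder_le_of_norm_deriv_le {x x' : ℝ → ℂ} {T K : ℝ} (hK : 0 ≤ K)
    (hx : ∀ t ∈ Ioo 0 T, HasDerivAt x (x' t) t) (hb : ∀ t ∈ Ioo 0 T, ‖x' t‖ ≤ K / √t) :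
    halfHolder (Ioo 0 T) x ≤ ENNReal.ofReal (2 * K) := by
  refine HolderWith.eHolderNorm_le (C := (2 * K).toNNReal) fun s t => ?_
  have key : ‖x s - x t‖ ≤ 2 * K * √|(s : ℝ) - t| := by
    rcases le_total (s : ℝ) t with h | h
    · rw [norm_sub_rev, abs_sub_comm, abs_of_nonneg (sub_nonneg.2 h)]
      exact norm_sub_le_two_mul_sqrt hK hx hb s.2 t.2 h
    · rw [abs_of_nonneg (sub_nonneg.2 h)]
      exact norm_sub_le_two_mul_sqrt hK hx hb t.2 s.2 h
  change edist (x s) (x t) ≤ _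
  rw [edist_dist, edist_dist, dist_eq_norm, Subtype.dist_eq, Real.dist_eq,
    ENNReal.ofReal_rpow_of_nonneg (abs_nonneg _) (by positivity),
    show ((2 * K).toNNReal : ℝ≥0∞) = ENNReal.ofReal (2 * K) from rfl,
    ← ENNReal.ofReal_mul (by positivity)]
  refine ENNReal.ofReal_le_ofReal (key.trans_eq ?_)
  rw [Real.sqrt_eq_rpow]
  norm_num

theorem halfHolder_mono {I J : Set ℝ} (h : I ⊆ J) (u : ℝ → ℂ) :
    halfHolder I u ≤ halfHolder J u :=
  le_iInf₂ fun _ hC => HolderWith.eHolderNorm_le fun s t => hC ⟨s, h s.2⟩ ⟨t, h t.2⟩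

theorem halfHolder_add_le (I : Set ℝ) (u v : ℝ → ℂ) :
    halfHolder I (fun t => u t + v t) ≤ halfHolder I u + halfHolder I v :=
  eHolderNorm_add_le (f := I.domRestrict u) (g := I.domRestrict v)

/-- Compare times `1` and `4`: the modulus of `selfSimilar` doubles from `√(2 * a)`, and the time
gap is `3`. -/
theorem le_halfHolder_selfSimilar (ha : 0 < a) (c : ℂ) :
    ENNReal.ofReal (‖c‖ * √(2 * a) / √3) ≤
      halfHolder (Ioi 0) (fun t => c * selfSimilar a b t) := by
  refine le_iInf₂ fun C hC => ?_
  have h := hC ⟨4, by norm_num⟩ ⟨1, by norm_num⟩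
  change edist (c * selfSimilar a b 4) (c * selfSimilar a b 1) ≤ _ at h
  rw [edist_dist, edist_dist, dist_eq_norm, Subtype.dist_eq, Real.dist_eq,
    ENNReal.ofReal_rpow_of_nonneg (abs_nonneg _) (by positivity), ← ENNReal.ofReal_coe_nnreal,
    ← ENNReal.ofReal_mul (by positivity),
    ENNReal.ofReal_le_ofReal_iff (by positivity)] at h
  have e3 : |(4 : ℝ) - 1| ^ (((1 / 2 : ℝ≥0)) : ℝ) = √3 := by
    rw [Real.sqrt_eq_rpow]
    norm_num
  rw [e3] at h
  have h2 := (norm_sub_norm_le _ _).trans h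
  have e4 : √(2 * a * 4) = √(2 * a) * 2 := by
    rw [Real.sqrt_mul (by positivity), show (4 : ℝ) = 2 ^ 2 by norm_num,
      Real.sqrt_sq (by norm_num)]
  rw [norm_mul, norm_mul, norm_selfSimilar, norm_selfSimilar, e4, mul_one] at h2
  rw [← ENNReal.ofReal_coe_nnreal]
  refine ENNReal.ofReal_le_ofReal ?_
  rw [div_le_iff₀ (by positivity)]
  linarith

end Holder

/-! ### The change to self-similar variables. -/

theorem vortexField_const_mul (ξ : ℝ) (c : ℂ) (z : Fin 3 → ℂ) (j : Fin 3) :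
    vortexField ξ (fun k => c * z k) j = c⁻¹ * vortexField ξ z j := by
  simp only [vortexField, ← mul_sub, Finset.mul_sum]
  refine Finset.sum_congr rfl fun k _ => ?_
  rw [div_eq_mul_inv _ (c * _), mul_inv]
  ring

/-- The external field in self-similar variables. -/
noncomputable def profileForcing (a b : ℝ) (α : Fin 3 → ℂ) (f : ℝ → ℂ → ℂ) (t : ℝ)
    (u : Fin 3 → ℂ) (j : Fin 3) : ℂ :=
  (2 * a : ℂ)⁻¹ * conj (selfSimilar a b t * f t (selfSimilar a b t * (α j + u j)))

section Forcing

variable {T M : ℝ} {f : ℝ → ℂ → ℂ}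

theorem norm_two_mul_inv (ha : 0 < a) : ‖(2 * a : ℂ)⁻¹‖ = (2 * a)⁻¹ := by
  rw [norm_inv, norm_mul, Complex.norm_real, Real.norm_of_nonneg ha.le]
  simp

theorem norm_profileForcing_le (ha : 0 < a) (hM : 0 ≤ M) (hf : normE T f ≤ ENNReal.ofReal M)
    {t : ℝ} (ht : t ∈ Ioo 0 T) (u : Fin 3 → ℂ) :
    ‖profileForcing a b α f t u‖ ≤ (2 * a)⁻¹ * √(2 * a) * M * √t := by
  rw [pi_norm_le_iff_of_nonneg (by positivity)]
  intro j
  rw [profileForcing, norm_mul, norm_two_mul_inv ha, RCLike.norm_conj, norm_mul,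
    norm_selfSimilar, Real.sqrt_mul (by positivity)]
  calc (2 * a)⁻¹ * (√(2 * a) * √t * ‖f t (selfSimilar a b t * (α j + u j))‖)
      ≤ (2 * a)⁻¹ * (√(2 * a) * √t * M) := by
        gcongr
        exact norm_le_of_normE_le hM hf (Ioo_subset_Ico_self ht) _
    _ = _ := by ring

/-- One factor `Z` multiplies the field and another scales its argument; since `|Z|² = 2at`, the
Lipschitz constant is of order `t`. -/
theorem norm_profileForcing_sub_le (ha : 0 < a) (hM : 0 ≤ M) (hE : MemE T f)
    (hf : normE T f ≤ ENNReal.ofReal M) {t : ℝ} (ht : t ∈ Ioo 0 T) (u v : Fin 3 → ℂ) :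
    ‖profileForcing a b α f t u - profileForcing a b α f t v‖ ≤ M * t * ‖u - v‖ := by
  have ht0 := ht.1
  rw [pi_norm_le_iff_of_nonneg (by positivity)]
  intro j
  set Z := selfSimilar a b t with hZ
  have e : (profileForcing a b α f t u - profileForcing a b α f t v) j =
      (2 * a : ℂ)⁻¹ * conj (Z * (f t (Z * (α j + u j)) - f t (Z * (α j + v j)))) := by
    simp only [Pi.sub_apply, profileForcing, ← hZ, map_sub, mul_sub]
  have hZn : ‖Z‖ * ‖Z‖ = 2 * a * t := by
    rw [hZ, norm_selfSimilar, Real.mul_self_sqrt (by positivity)]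
  rw [e, norm_mul, norm_two_mul_inv ha, RCLike.norm_conj, norm_mul]
  calc (2 * a)⁻¹ * (‖Z‖ * ‖f t (Z * (α j + u j)) - f t (Z * (α j + v j))‖)
      ≤ (2 * a)⁻¹ * (‖Z‖ * (M * (‖Z‖ * ‖u - v‖))) := by
        gcongr
        refine (norm_sub_le_of_normE_le hM hE hf (Ioo_subset_Ico_self ht) _ _).trans ?_
        rw [← mul_sub, norm_mul, add_sub_add_left_eq_sub]
        gcongr
        exact norm_le_pi_norm (u - v) j
    _ = (2 * a)⁻¹ * M * (‖Z‖ * ‖Z‖) * ‖u - v‖ := by ring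
    _ = M * t * ‖u - v‖ := by rw [hZn]; field_simp

theorem continuousOn_profileForcing (ha : 0 < a) (hM : 0 ≤ M) (hE : MemE T f)
    (hf : normE T f ≤ ENNReal.ofReal M) :
    ContinuousOn (Function.uncurry (profileForcing a b α f)) (Ioo 0 T ×ˢ univ) := by
  rw [continuousOn_pi]
  intro j
  have hZ : ContinuousOn (fun x : ℝ × (Fin 3 → ℂ) => selfSimilar a b x.1) (Ioo 0 T ×ˢ univ) :=
    (contDiffOn_selfSimilar ha).continuousOn.comp continuousOn_fst fun x hx => hx.1
  have hp : ContinuousOn (fun x : ℝ × (Fin 3 → ℂ) =>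
      (x.1, selfSimilar a b x.1 * (α j + x.2 j))) (Ioo 0 T ×ˢ univ) :=
    continuousOn_fst.prodMk (hZ.mul (Continuous.continuousOn (by fun_prop)))
  have hfp := (continuousOn_of_normE_le hM hE hf).comp hp fun x hx => ⟨hx.1, mem_univ _⟩
  exact continuousOn_const.mul (continuous_conj.comp_continuousOn (hZ.mul hfp))

end Forcing

/-- A solution of the equation in self-similar variables gives a solution of the vortex system. -/
theorem IsBurstParam.hasDerivAt_conj_mul (h : IsBurstParam ξ a b α) {f : ℝ → ℂ → ℂ}
    {u : ℝ → Fin 3 → ℂ} {t : ℝ} (ht : 0 < t)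
    (hu : HasDerivAt u (t⁻¹ • (profileField ξ a b α (u t) + profileForcing a b α f t (u t))) t)
    (j : Fin 3) :
    HasDerivAt (fun s => conj (selfSimilar a b s * (α j + u s j)))
      (vortexField ξ (fun k => selfSimilar a b t * (α k + u t k)) j +
        f t (selfSimilar a b t * (α j + u t j))) t := by
  have h1 := ((hasDerivAt_selfSimilar (b := b) h.pos ht).mul
    ((hasDerivAt_pi.1 hu j).const_add (α j)))
  refine ((conjCLE : ℂ →L[ℝ] ℂ).hasFDerivAt.comp_hasDerivAt t h1).congr_deriv ?_
  have ha' : (a : ℂ) ≠ 0 := by exact_mod_cast h.pos.ne'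
  have ht' : (t : ℂ) ≠ 0 := by exact_mod_cast ht.ne'
  have hZ := selfSimilar_ne_zero (b := b) h.pos ht
  have hZ2 := selfSimilar_mul_conj (b := b) h.pos ht
  have hα : (fun k => α k + u t k) = α + u t := rfl
  rw [vortexField_const_mul, hα]
  simp only [Pi.smul_apply, Pi.add_apply, profileField, profileForcing, real_smul]
  set Z := selfSimilar a b t
  set F := vortexField ξ (α + u t) j
  set w := f t (Z * (α j + u t j))
  -- Trading `conj Z` for `Z⁻¹` matches the degree `-1` of the vortex field and leaves a rational
  -- identity.
  have hc : conj Z = 2 * a * t / Z := by rw [← hZ2]; field_simp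
  simp only [ContinuousLinearEquiv.coe_coe, conjCLE_apply, map_add, map_mul, map_sub, map_div₀,
    map_inv₀, conj_conj, conj_ofReal, map_ofNat, ofReal_inv]
  rw [hc]
  field_simp
  ring

/-! ### Construction of the burst and its bounds. -/

theorem exists_burst (hα : IsBurstParam ξ a b α) {M ρ : ℝ} (hM : 0 < M) (hρ : 0 < ρ) :
    ∃ Tstar : ℝ, 0 < Tstar ∧ ∀ T : ℝ, 0 < T → T < Tstar →
      ∀ f : ℝ → ℂ → ℂ, MemE T f → normE T f ≤ ENNReal.ofReal M →
        ∃ z : ℝ → EuclideanSpace ℂ (Fin 3),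
          ContDiffOn ℝ 1 z (Ioo 0 T) ∧
          SolvesVortex ξ T f z ∧
          (∀ j, Tendsto (fun t => z t j) (𝓝[>] 0) (𝓝 0)) ∧
          (∀ j, halfHolder (Ioo 0 T) (fun t => z t j) ≤
            3 * halfHolder (Ioi 0) (fun t => α j * selfSimilar a b t)) ∧
          ∀ t ∈ Ioo 0 T, ‖z t‖ ≤ ρ := by
  have ha := hα.pos
  obtain ⟨Ψ, η, q, hη, hq0, hq1, hdiss⟩ := hα.exists_dissipative_coordinates
  have hV := hα.hasStrictFDerivAt_profileField
  have hV0 := hα.profileField_zero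
  -- `K` bounds the Hölder seminorms of all three self-similar vortices from below
  obtain ⟨K, hK0, hK⟩ : ∃ K > 0, ∀ j, K ≤ ‖α j‖ * √(2 * a) / √3 := by
    have : ∀ᶠ K in 𝓝[>] (0 : ℝ), ∀ j, K ≤ ‖α j‖ * √(2 * a) / √3 := by
      refine eventually_all.2 fun j => nhdsWithin_le_nhds (eventually_le_nhds ?_)
      have := norm_pos_iff.2 (hα.ne_zero j)
      positivity
    obtain ⟨K, hK, hK0⟩ := (this.and self_mem_nhdsWithin).exists
    exact ⟨K, hK0, hK⟩
  let κ := burstRate a b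
  -- Three terms of size `μ` will bound the derivative of `Z u_j`: `κ u_j`, the profile field and
  -- the forcing.
  obtain ⟨μ, hμ0, hμ⟩ : ∃ μ > 0, √(2 * a) * (3 * μ) = K :=
    ⟨K / √(2 * a) / 3, by positivity, by field_simp⟩
  obtain ⟨δ, hδ0, hδ⟩ : ∃ δ > 0, ∀ u : Fin 3 → ℂ, ‖u‖ ≤ δ →
      ‖u‖ ≤ 1 ∧ ‖κ‖ * ‖u‖ ≤ μ ∧ ‖profileField ξ a b α u‖ ≤ μ ∧
        ∀ j k, j ≠ k → α j + u j ≠ α k + u k := by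
    have h1 : ∀ᶠ u : Fin 3 → ℂ in 𝓝 0, ‖u‖ < 1 :=
      continuous_norm.continuousAt.eventually_lt continuousAt_const (by simp)
    have h2 : ∀ᶠ u : Fin 3 → ℂ in 𝓝 0, ‖κ‖ * ‖u‖ < μ :=
      (by fun_prop : Continuous fun u : Fin 3 → ℂ => ‖κ‖ * ‖u‖).continuousAt.eventually_lt
        continuousAt_const (by simpa using hμ0)
    have h3 : ∀ᶠ u : Fin 3 → ℂ in 𝓝 0, ‖profileField ξ a b α u‖ < μ :=
      hV.continuousAt.norm.eventually_lt continuousAt_const (by simpa [hV0] using hμ0)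
    have h4 : ∀ᶠ u : Fin 3 → ℂ in 𝓝 0, ∀ j k, j ≠ k → α j + u j ≠ α k + u k := by
      refine eventually_all.2 fun j => eventually_all.2 fun k => ?_
      by_cases hjk : j = k
      · simp [hjk]
      · have hc : ∀ᶠ u : Fin 3 → ℂ in 𝓝 0, α j + u j - (α k + u k) ≠ 0 :=
          (by fun_prop : Continuous fun u : Fin 3 → ℂ =>
            α j + u j - (α k + u k)).continuousAt.eventually_ne
            (by simpa using hα.sub_ne_zero hjk)
        exact hc.mono fun u hu _ => sub_ne_zero.1 hu
    obtain ⟨δ, hδ0, hδ⟩ := Metric.nhds_basis_closedBall.eventually_iff.1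
      (h1.and (h2.and (h3.and h4)))
    refine ⟨δ, hδ0, fun u hu => ?_⟩
    obtain ⟨k1, k2, k3, k4⟩ := hδ (show u ∈ Metric.closedBall 0 δ by simpa using hu)
    exact ⟨k1.le, k2.le, k3.le, k4⟩
  let C : ℝ := M + (2 * a)⁻¹ * √(2 * a) * M
  have hC1 : M ≤ C := le_add_of_nonneg_right (by positivity)
  have hC2 : (2 * a)⁻¹ * √(2 * a) * M ≤ C := le_add_of_nonneg_left hM.le
  have hC0 : 0 < C := hM.trans_le hC1
  obtain ⟨T₀, hT₀, hsol⟩ := exists_small_solution hV hV0 Ψ hη hq0 hq1 hdiss hC0 hδ0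
  let A : ℝ := ‖α‖ + 1
  have hA0 : 0 < A := by positivity
  -- These thresholds serve, in order, existence of `u`, forcing at most `μ`, and coordinates of `z`
  -- at most `ρ / 2`.
  refine ⟨min T₀ (min ((μ / C) ^ 2) ((ρ / (2 * A)) ^ 2 / (2 * a))), by positivity,
    fun T hT0 hT f hE hf => ?_⟩
  have hT1 : T < T₀ := hT.trans_le (min_le_left _ _)
  have hT2 : T ≤ (μ / C) ^ 2 := hT.le.trans ((min_le_right _ _).trans (min_le_left _ _))
  have hT3 : T ≤ (ρ / (2 * A)) ^ 2 / (2 * a) :=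
    hT.le.trans ((min_le_right _ _).trans (min_le_right _ _))
  obtain ⟨u, hu, hu1⟩ := hsol T hT0 hT1 (profileForcing a b α f)
    (continuousOn_profileForcing ha hM.le hE hf)
    (fun t ht x y => (norm_profileForcing_sub_le ha hM.le hE hf ht x y).trans (by
      have := ht.1
      gcongr))
    (fun t ht x => (norm_profileForcing_le ha hM.le hf ht x).trans (by gcongr))
  let z : ℝ → EuclideanSpace ℂ (Fin 3) := fun t =>
    WithLp.toLp 2 fun j => selfSimilar a b t * (α j + u t j)
  have hz : ∀ t j, z t j = selfSimilar a b t * (α j + u t j) := fun _ _ => rfl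
  have hnorm : ∀ t ∈ Ioo 0 T, ∀ j, ‖z t j‖ ≤ √(2 * a * t) * A := by
    intro t ht j
    rw [hz, norm_mul, norm_selfSimilar]
    gcongr
    exact (norm_add_le _ _).trans (add_le_add (norm_le_pi_norm α j)
      ((norm_le_pi_norm (u t) j).trans (hδ _ (hu t ht).1).1))
  refine ⟨z, ?_, ?_, ?_, ?_, ?_⟩
  · exact (PiLp.continuousLinearEquiv 2 ℝ fun _ : Fin 3 => ℂ).symm.contDiff.comp_contDiffOn
      (contDiffOn_pi.2 fun j =>
        (contDiffOn_selfSimilar ha).mul (contDiffOn_const.add (contDiffOn_pi.1 hu1 j)))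
  · refine fun t ht => ⟨?_, fun j => hα.hasDerivAt_conj_mul ht.1 (hu t ht).2 j⟩
    rintro ⟨j, k, hjk, he⟩
    exact (hδ _ (hu t ht).1).2.2.2 j k hjk
      (mul_left_cancel₀ (selfSimilar_ne_zero ha ht.1) he)
  · intro j
    have hlim : Tendsto (fun t : ℝ => √(2 * a * t) * A) (𝓝[>] 0) (𝓝 0) := by
      have : Continuous fun t : ℝ => √(2 * a * t) * A := by fun_prop
      simpa using (this.continuousWithinAt (s := Ioi 0) (x := 0)).tendsto
    refine squeeze_zero_norm' ?_ hlim
    filter_upwards [Ioo_mem_nhdsGT hT0] with t ht using hnorm t ht j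
  · intro j
    have hx : ∀ t ∈ Ioo 0 T, HasDerivAt (fun t => selfSimilar a b t * u t j)
        (selfSimilar a b t * κ / t * u t j + selfSimilar a b t * (t⁻¹ •
          (profileField ξ a b α (u t) + profileForcing a b α f t (u t))) j) t := fun t ht =>
      (hasDerivAt_selfSimilar ha ht.1).mul (hasDerivAt_pi.1 (hu t ht).2 j)
    have hb : ∀ t ∈ Ioo 0 T, ‖selfSimilar a b t * κ / t * u t j + selfSimilar a b t * (t⁻¹ •
          (profileField ξ a b α (u t) + profileForcing a b α f t (u t))) j‖ ≤ K / √t := by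
      intro t ht
      have ht0 := ht.1
      obtain ⟨-, k2, k3, -⟩ := hδ _ (hu t ht).1
      have e : selfSimilar a b t * κ / t * u t j + selfSimilar a b t * (t⁻¹ •
          (profileField ξ a b α (u t) + profileForcing a b α f t (u t))) j =
          selfSimilar a b t / t * (κ * u t j + (profileField ξ a b α (u t) j +
            profileForcing a b α f t (u t) j)) := by
        simp only [Pi.smul_apply, Pi.add_apply, real_smul, ofReal_inv]
        ring
      have n1 : ‖κ * u t j‖ ≤ μ := by
        rw [norm_mul]
        exact (mul_le_mul_of_nonneg_left (norm_le_pi_norm _ j) (norm_nonneg _)).trans k2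
      have n2 := (norm_le_pi_norm (profileField ξ a b α (u t)) j).trans k3
      have n3 : ‖profileForcing a b α f t (u t) j‖ ≤ μ := by
        refine (norm_le_pi_norm (profileForcing a b α f t (u t)) j).trans
          ((norm_profileForcing_le ha hM.le hf ht (u t)).trans ?_)
        calc (2 * a)⁻¹ * √(2 * a) * M * √t ≤ C * √((μ / C) ^ 2) := by
              gcongr
              exact ht.2.le.trans hT2
          _ = μ := by rw [Real.sqrt_sq (by positivity)]; field_simp
      rw [e, norm_mul, norm_div, norm_selfSimilar, Complex.norm_real,
        Real.norm_of_nonneg ht0.le, Real.sqrt_mul (by positivity)]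
      calc √(2 * a) * √t / t * ‖κ * u t j + (profileField ξ a b α (u t) j +
            profileForcing a b α f t (u t) j)‖ ≤ √(2 * a) * √t / t * (3 * μ) := by
            gcongr
            refine (norm_add_le _ _).trans ?_
            linarith [norm_add_le (profileField ξ a b α (u t) j)
              (profileForcing a b α f t (u t) j)]
        _ = K * (√t / t) := by rw [← hμ]; ring
        _ = K / √t := by rw [Real.sqrt_div_self, div_eq_mul_inv]
    have hsum : (fun t => z t j) = fun t => α j * selfSimilar a b t + selfSimilar a b t * u t j := by
      funext t
      rw [hz]
      ring
    have hlow : ENNReal.ofReal K ≤ halfHolder (Ioi 0) (fun t => α j * selfSimilar a b t) :=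
      (ENNReal.ofReal_le_ofReal (hK j)).trans (le_halfHolder_selfSimilar ha (α j))
    rw [hsum]
    calc halfHolder (Ioo 0 T) (fun t => α j * selfSimilar a b t + selfSimilar a b t * u t j)
        ≤ halfHolder (Ioo 0 T) (fun t => α j * selfSimilar a b t) +
          halfHolder (Ioo 0 T) (fun t => selfSimilar a b t * u t j) := halfHolder_add_le _ _ _
      _ ≤ halfHolder (Ioi 0) (fun t => α j * selfSimilar a b t) + ENNReal.ofReal (2 * K) :=
          add_le_add (halfHolder_mono Ioo_subset_Ioi_self _)
            (halfHolder_le_of_norm_deriv_le hK0.le hx hb)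
      _ ≤ halfHolder (Ioi 0) (fun t => α j * selfSimilar a b t) +
          2 * halfHolder (Ioi 0) (fun t => α j * selfSimilar a b t) := by
          rw [ENNReal.ofReal_mul (by norm_num), ENNReal.ofReal_ofNat]
          gcongr
      _ = 3 * halfHolder (Ioi 0) (fun t => α j * selfSimilar a b t) := by ring
  · intro t ht
    -- Half of `ρ` per coordinate suffices for the Euclidean norm, as `3 (ρ / 2)² ≤ ρ²`.
    have hzj : ∀ j, ‖z t j‖ ≤ ρ / 2 := by
      intro j
      refine (hnorm t ht j).trans ?_
      calc √(2 * a * t) * A ≤ √((ρ / (2 * A)) ^ 2) * A := by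
            gcongr
            have := ht.2.le.trans hT3
            rw [le_div_iff₀ (by positivity)] at this
            linarith
        _ = ρ / 2 := by rw [Real.sqrt_sq (by positivity)]; field_simp
    rw [EuclideanSpace.norm_eq, Real.sqrt_le_left hρ.le]
    calc ∑ j, ‖z t j‖ ^ 2 ≤ ∑ _j : Fin 3, (ρ / 2) ^ 2 := by
          gcongr with j
          exact hzj j
      _ ≤ ρ ^ 2 := by
          simp
          nlinarith [sq_nonneg ρ]

end VortexBurst

theorem mainTheorem2 (ξ : ℝ) (hξ : ξ ≠ 0) (a b : ℝ) (α : Fin 3 → ℂ)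
    (hα : VortexBurst.IsBurstParam ξ a b α) (M ρ : ℝ) (hM : 0 < M) (hρ : 0 < ρ) :
    ∃ Tstar : ℝ, 0 < Tstar ∧ ∀ T : ℝ, 0 < T → T < Tstar →
      ∀ f : ℝ → ℂ → ℂ, VortexBurst.MemE T f → VortexBurst.normE T f ≤ ENNReal.ofReal M →
        ∃ z : ℝ → EuclideanSpace ℂ (Fin 3),
          ContDiffOn ℝ 1 z (Ioo 0 T) ∧
          VortexBurst.SolvesVortex ξ T f z ∧
          (∀ j, Tendsto (fun t => z t j) (𝓝[>] 0) (𝓝 0)) ∧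
          (∀ j, VortexBurst.halfHolder (Ioo 0 T) (fun t => z t j) ≤
            3 * VortexBurst.halfHolder (Ioi 0) (fun t => α j * VortexBurst.selfSimilar a b t)) ∧
          ∀ t ∈ Ioo 0 T, ‖z t‖ ≤ ρ :=
  VortexBurst.exists_burst hα hM hρ
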